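/- Let $\Delta^n=\operatorname{conv}\{p_0,\dots,p_n\}$ and $\Delta^m=\operatorname{conv}\{q_0,\dots,q_m\}$ be simplices (with affinely independent vertices), and let $T$ be a finite triangulation of $P=\Delta^n\times\Delta^m$ (a finite set of simplices, closed under taking faces, with union $P$, any two of which are disjoint or meet in a common face; vertices of $T$ need not be extreme points of $P$). The extreme points of $P$ are the $(n+1)(m+1)$ points $(p_i,q_j)$, and its cells are the products of a face of $\Delta^n$ with a face of $\Delta^m$. Let $f$ be a labelling of the vertices of $T$ by $(n+1)(m+1)$ colours such that the extreme points of $P$ have pairwise different colours and which is a generalized Sperner labelling: whenever a vertex $v$ of $T$ lies in a cell $c$ of $P$, $f(v)$ is the colour of some extreme point of $P$ contained in the affine span of $c$. For $k=(k_0,\dots,k_m)$, a $(k_0,\dots,k_m)$-simplex on the vertices of $P$ is an $(n+m)$-simplex (with affinely independent vertices) whose vertices are extreme points of $P$, exactly $k_j$ of them lying in $\Delta^n\times\{q_j\}$ for each $j$. A simplex $\sigma\in T$ is labelled as $\sigma'$ if there is a bijection from the vertices of $\sigma$ to the vertices of $\sigma'$ preserving colours; $\sigma$ then has the same (respectively,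 the opposite) orientation as $\sigma'$ if the affine map $\sigma'\to\sigma$ extending the inverse of that bijection has positive (respectively, negative) determinant. Then for all positive integers $k_0,\dots,k_m$ with $k_0+\dots+k_m=n+m+1$: 1. the number of simplices $\sigma\in T$ that are labelled as some $(k_0,\dots,k_m)$-simplex $\sigma'$ on the vertices of $P$ is odd; 2. the number of such $\sigma$ having the same orientation as the corresponding $\sigma'$ is exactly one more than the number of such $\sigma$ having the opposite orientation. -/

import Mathlib

namespace SimplexProduct

/-- A triangulation of a set `P`: a finite geometric simplicial complex (closed under passing to
faces, two simplices meeting in a common face or not at all) whose simplices cover exactly `P`.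
A simplex is recorded through the finite set of its vertices. -/
structure IsTriangulation {V : Type*} [AddCommGroup V] [Module ℝ V]
    (T : Geometry.SimplicialComplex ℝ V) (P : Set V) : Prop where
  finite : T.faces.Finite
  space_eq : T.space = P

/-- A labelling `f` of the vertices of `T` is a generalized Sperner labelling, relative to the
cells and the vertices of a polytope, if each vertex `v` of `T` that lies in a cell `c` gets the
label of one of the vertices of the polytope that lie in the affine span of `c`.
Only the values of `f` at vertices of `T` and of the polytope matter. -/
def IsGeneralizedSperner {V C : Type*} [AddCommGroup V] [Module ℝ V]
    (cells : Set (Set V)) (verts : Set V) (T : Geometry.SimplicialComplex ℝ V)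
    (f : V → C) : Prop :=
  ∀ v ∈ T.vertices, ∀ c ∈ cells, v ∈ c → ∃ w ∈ verts, w ∈ affineSpan ℝ c ∧ f v = f w

section Product

variable {E F : Type*} [AddCommGroup E] [Module ℝ E] [AddCommGroup F] [Module ℝ F] {n m : ℕ}

/-- The product of the simplex with vertices `p 0, …, p n` and the one with vertices
`q 0, …, q m`. -/
def productPolytope (p : Fin (n + 1) → E) (q : Fin (m + 1) → F) : Set (E × F) :=
  convexHull ℝ (Set.range p) ×ˢ convexHull ℝ (Set.range q)

/-- The extreme points of the product of two simplices. -/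
def productVertices (p : Fin (n + 1) → E) (q : Fin (m + 1) → F) : Set (E × F) :=
  Set.range p ×ˢ Set.range q

/-- The cells of the product of two simplices: the products of a face of the first one and a face
of the second one (the whole product included). -/
def productCells (p : Fin (n + 1) → E) (q : Fin (m + 1) → F) : Set (Set (E × F)) :=
  {c | ∃ (I : Finset (Fin (n + 1))) (J : Finset (Fin (m + 1))), I.Nonempty ∧ J.Nonempty ∧
    c = convexHull ℝ (p '' I) ×ˢ convexHull ℝ (q '' J)}

/-- `τ` is the vertex set of a `(k 0, …, k m)`-simplex on the vertices of the product: an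
`(n + m)`-simplex whose vertices are extreme points of the product, exactly `k j` of which project
to the vertex `q j` of the second factor. -/
structure IsTypeSimplex (p : Fin (n + 1) → E) (q : Fin (m + 1) → F) (k : Fin (m + 1) → ℕ)
    (τ : Finset (E × F)) : Prop where
  subset : (τ : Set (E × F)) ⊆ productVertices p q
  card_eq : τ.card = n + m + 1
  indep : AffineIndependent ℝ ((↑) : τ → E × F)
  type_eq : ∀ j, {v | v ∈ τ ∧ v.2 = q j}.ncard = k j

end Product

section Orientation

variable {V C : Type*} [AddCommGroup V] [Module ℝ V]

/-- `A` expresses the points `s i` in barycentric coordinates with respect to the points `t j`.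
If `s` and `t` list the vertices of two simplices of the same dimension, then `A.det` is the
factor by which the affine map `t j ↦ s j` multiplies oriented volume. -/
def IsBarycentricMatrix {ι : Type*} [Fintype ι] (s t : ι → V) (A : Matrix ι ι ℝ) : Prop :=
  ∀ i, ∑ j, A i j = 1 ∧ s i = ∑ j, A i j • t j

open Classical in
/-- The simplices with (correspondingly listed) vertices `s` and `t` have the same orientation. -/
def SameOrientation {ι : Type*} [Fintype ι] (s t : ι → V) : Prop :=
  ∃ A : Matrix ι ι ℝ, IsBarycentricMatrix s t A ∧ 0 < A.det

open Classical in
/-- The simplices with (correspondingly listed) vertices `s` and `t` have opposite orientations. -/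
def OppositeOrientation {ι : Type*} [Fintype ι] (s t : ι → V) : Prop :=
  ∃ A : Matrix ι ι ℝ, IsBarycentricMatrix s t A ∧ A.det < 0

/-- A label-preserving bijection between the vertices of two simplices. -/
def PreservesLabels (f : V → C) {σ τ : Finset V} (e : σ ≃ τ) : Prop :=
  ∀ v : σ, f (e v) = f v

/-- `σ` is labelled as `τ`. -/
def LabelledAs (f : V → C) (σ τ : Finset V) : Prop :=
  ∃ e : σ ≃ τ, PreservesLabels f e

/-- `σ` is labelled as `τ`, and has the same orientation when the vertices with equal labels
correspond to each other. -/
def LabelledAsSame (f : V → C) (σ τ : Finset V) : Prop :=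
  ∃ e : σ ≃ τ, PreservesLabels f e ∧
    SameOrientation (fun v : σ => (v : V)) (fun v : σ => (e v : V))

/-- `σ` is labelled as `τ`, and has the opposite orientation when the vertices with equal labels
correspond to each other. -/
def LabelledAsOpposite (f : V → C) (σ τ : Finset V) : Prop :=
  ∃ e : σ ≃ τ, PreservesLabels f e ∧
    OppositeOrientation (fun v : σ => (v : V)) (fun v : σ => (e v : V))

end Orientation

end SimplexProduct

set_option linter.unusedSectionVars false

/-! In barycentric coordinates the extreme points of `P` become the vectors `e_i + e_j`. The cone
over `P` is the cone of nonnegative balanced vectors, its faces are given by vanishing coordinates,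
and a triangulation of `P` becomes a simplicial fan (`IsTriangulation.isFan`). The Sperner condition
says that each vertex of `T` is sent to an extreme point at whose two indices its own coordinates
are positive (`IsLabelling`). To an enumerated simplex attach the orientation of its vertex vectors
times `typeDet`, which is the determinant of its label vectors when the labels have type `k` and
zero otherwise. The core claim is that these products add up to `(n + m + 1)!`
(`total_eq_factorial`).

The determinant restricted to a single type is still a cocycle: replacing the labels one at a time
by a fixed `w = (i, j)` and adding the results gives back the original value
(`typeDet_eq_sum_update`). This is Cramer's rule paired with a functional that sees only the second
index. The signed count thereby becomes a sum over facets, each weighted by the orientations of the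
simplices around it (`total_eq_sum_linkSum`). Interior facets cancel, being met from two opposite
sides (`linkSum_of_interior`); a facet in the boundary is met from one side only
(`linkSum_of_mem_facet`).

The vertex `w` is used so that a single boundary face contributes: the one omitting `p_i` if `k j ≥
2`, and the one omitting `q_j` if `k j = 1`. All others give a zero determinant or a wrong type
(`typeDet_cons_eq_zero`). Thus the count for `k` is `r + 1` times the count on that face for `k`
lowered by one at `j` (`total_succ`), and induction ends at the empty simplex.

Label determinants are `0`, `1` or `-1` (`coordDet_vertexVector`), since they are minors of a
bipartite incidence matrix. So each unordered simplex contributes `1`, `-1` or `0`, with the sign of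
the map to its label simplex (`IsBarycentricMatrix.coordDet_eq`). The contributions add up to `1`,
which is the signed statement, and oddness is its reduction modulo two. -/

namespace SimplexProduct

/-! ### Balanced vectors, charts of faces, and determinant identities -/

section Coordinates

variable {ι κ : Type*} [Fintype ι] [Fintype κ] [DecidableEq ι] [DecidableEq κ] {r : ℕ}

/-- The coordinate vector of a vertex of the product of two simplices. -/
def vertexVector (y : ι × κ) : ι ⊕ κ → ℝ := Sum.elim (Pi.single y.1 1) (Pi.single y.2 1)

/-- The two groups of coordinates have the same sum. -/
def Balanced (z : ι ⊕ κ → ℝ) : Prop := ∑ i, z (.inl i) = ∑ j, z (.inr j)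

/-- The coordinates outside `L` vanish. -/
def SupportedIn {l : Type*} (L : Finset l) (z : l → ℝ) : Prop := ∀ i ∉ L, z i = 0

/-- The determinant of the vectors `z i` in the coordinates `col c`. -/
noncomputable def coordDet {l : Type*} (col : Fin r → l) (z : Fin r → l → ℝ) : ℝ :=
  (Matrix.of fun i c => z i (col c)).det

/-- `col` lists the elements of `L` other than `i₀`. -/
structure IsChart (L : Finset (ι ⊕ κ)) (i₀ : ι) (col : Fin r → ι ⊕ κ) : Prop where
  mem : .inl i₀ ∈ L
  inj : Function.Injective col
  range : ∀ l, l ∈ Set.range col ↔ l ∈ L ∧ l ≠ .inl i₀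

lemma vertexVector_nonneg (y : ι × κ) (l : ι ⊕ κ) : 0 ≤ vertexVector y l := by
  rcases l with i | j
  · simp only [vertexVector, Sum.elim_inl, Pi.single_apply]; split_ifs <;> norm_num
  · simp only [vertexVector, Sum.elim_inr, Pi.single_apply]; split_ifs <;> norm_num

lemma vertexVector_balanced (y : ι × κ) : Balanced (vertexVector y) := by
  simp [Balanced, vertexVector, Pi.single_apply]

lemma vertexVector_ne_zero_iff (y : ι × κ) (l : ι ⊕ κ) :
    vertexVector y l ≠ 0 ↔ l = .inl y.1 ∨ l = .inr y.2 := by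
  rcases l with i | j <;> simp [vertexVector, Pi.single_apply]

lemma Balanced.add {y z : ι ⊕ κ → ℝ} (hy : Balanced y) (hz : Balanced z) :
    Balanced (y + z) := by
  simp only [Balanced, Pi.add_apply, Finset.sum_add_distrib] at *; rw [hy, hz]

lemma Balanced.smul {y : ι ⊕ κ → ℝ} (hy : Balanced y) (c : ℝ) : Balanced (c • y) := by
  simp only [Balanced, Pi.smul_apply, smul_eq_mul, ← Finset.mul_sum] at *; rw [hy]

lemma Balanced.zero : Balanced (0 : ι ⊕ κ → ℝ) := by simp [Balanced]

lemma Balanced.sum {α : Type*} (s : Finset α) {z : α → ι ⊕ κ → ℝ} (h : ∀ a, Balanced (z a)) :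
    Balanced (∑ a ∈ s, z a) := by
  classical
  induction s using Finset.induction_on with
  | empty => simpa using Balanced.zero
  | insert a s ha ih => rw [Finset.sum_insert ha]; exact (h a).add ih

lemma SupportedIn.add {l : Type*} {L : Finset l} {y z : l → ℝ} (hy : SupportedIn L y)
    (hz : SupportedIn L z) : SupportedIn L (y + z) := fun i hi => by
  simp [hy i hi, hz i hi]

lemma SupportedIn.smul {l : Type*} {L : Finset l} {y : l → ℝ} (hy : SupportedIn L y)
    (c : ℝ) : SupportedIn L (c • y) := fun i hi => by simp [hy i hi]

lemma SupportedIn.sum {l α : Type*} {L : Finset l} (s : Finset α) {z : α → l → ℝ}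
    (h : ∀ a, SupportedIn L (z a)) : SupportedIn L (∑ a ∈ s, z a) := fun i hi => by
  rw [Finset.sum_apply]; exact Finset.sum_eq_zero fun a _ => h a i hi

/-- On balanced vectors supported in `L`, the coordinate dropped by a chart is a combination of
the other ones with coefficients `-1` and `1`. -/
lemma IsChart.dropped_eq {L : Finset (ι ⊕ κ)} {i₀ : ι} {col : Fin r → ι ⊕ κ}
    (h : IsChart L i₀ col) {z : ι ⊕ κ → ℝ} (hz : Balanced z) (hs : SupportedIn L z) :
    z (.inl i₀) = ∑ c, Sum.elim (fun _ => (-1 : ℝ)) (fun _ => 1) (col c) * z (col c) := by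
  -- With these signs, being balanced reads `∑ l, ε l * z l = 0`; the term at `i₀` is then isolated.
  set ε : ι ⊕ κ → ℝ := Sum.elim (fun _ => (-1 : ℝ)) (fun _ => 1) with hε
  have h0 : ∑ l, ε l * z l = 0 := by
    rw [Fintype.sum_sum_type]; simp only [hε, Sum.elim_inl, Sum.elim_inr, neg_mul, one_mul,
      Finset.sum_neg_distrib]
    rw [hz.symm.symm]; ring
  have h1 : ∑ c, ε (col c) * z (col c) = ∑ l ∈ Finset.univ.erase (.inl i₀), ε l * z l := by
    rw [← Finset.sum_image (s := Finset.univ) (g := col) (f := fun l => ε l * z l)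
      (fun a _ b _ hab => h.inj hab)]
    apply Finset.sum_subset
    · intro l hl
      obtain ⟨c, -, rfl⟩ := Finset.mem_image.1 hl
      exact Finset.mem_erase.2 ⟨((h.range _).1 ⟨c, rfl⟩).2, Finset.mem_univ _⟩
    · intro l hl hl'
      have : l ∉ L := fun hL => hl' (by
        obtain ⟨c, hc⟩ := (h.range l).2 ⟨hL, (Finset.mem_erase.1 hl).1⟩
        exact Finset.mem_image.2 ⟨c, Finset.mem_univ _, hc⟩)
      rw [hs l this, mul_zero]
  rw [h1]
  rw [← Finset.add_sum_erase _ _ (Finset.mem_univ (Sum.inl i₀))] at h0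
  have : ε (.inl i₀) = -1 := rfl
  rw [this] at h0; linarith

/-- Every coordinate in `L` is a nonzero functional of the coordinates of a chart, on balanced
vectors supported in `L`. -/
lemma IsChart.exists_functional {L : Finset (ι ⊕ κ)} {i₀ : ι} {col : Fin r → ι ⊕ κ}
    (h : IsChart L i₀ col) (hr : 0 < r) {l : ι ⊕ κ} (hl : l ∈ L) :
    ∃ ξ : Fin r → ℝ, ξ ≠ 0 ∧ ∀ z : ι ⊕ κ → ℝ, Balanced z → SupportedIn L z →
      z l = ∑ c, ξ c * z (col c) := by
  by_cases hl0 : l = .inl i₀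
  · subst hl0
    refine ⟨fun c => Sum.elim (fun _ => (-1 : ℝ)) (fun _ => 1) (col c), fun h0 => ?_,
      fun z hz hs => h.dropped_eq hz hs⟩
    have := congrFun h0 ⟨0, hr⟩
    rcases hc : col ⟨0, hr⟩ with i | j <;> simp [hc] at this
  · obtain ⟨c, rfl⟩ := (h.range l).2 ⟨hl, hl0⟩
    refine ⟨Pi.single c 1, by simp, fun z _ _ => ?_⟩
    simp [Pi.single_apply]

/-- A chart is injective on the balanced vectors of its face, so vector identities need only be
checked on its columns. -/
lemma IsChart.eq_zero {L : Finset (ι ⊕ κ)} {i₀ : ι} {col : Fin r → ι ⊕ κ}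
    (h : IsChart L i₀ col) {z : ι ⊕ κ → ℝ} (hz : Balanced z) (hs : SupportedIn L z)
    (h0 : ∀ c, z (col c) = 0) : z = 0 := by
  funext l
  by_cases hl0 : l = .inl i₀
  · rw [hl0, h.dropped_eq hz hs]; simp [h0]
  · by_cases hl : l ∈ L
    · obtain ⟨c, rfl⟩ := (h.range l).2 ⟨hl, hl0⟩
      exact h0 c
    · exact hs l hl

lemma coordDet_eq_zero_of_functional {l : Type*} {col : Fin r → l} {z : Fin r → l → ℝ}
    {ξ : Fin r → ℝ} (hξ : ξ ≠ 0) (h : ∀ i, ∑ c, ξ c * z i (col c) = 0) :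
    coordDet col z = 0 := by
  refine Matrix.exists_mulVec_eq_zero_iff.1 ⟨ξ, hξ, ?_⟩
  funext i
  simp only [Matrix.mulVec, dotProduct, Matrix.of_apply, Pi.zero_apply, ← h i, mul_comm]

/-- Vectors lying in a facet of the face `L` are degenerate with respect to a chart of `L`. -/
lemma IsChart.coordDet_eq_zero {L : Finset (ι ⊕ κ)} {i₀ : ι} {col : Fin r → ι ⊕ κ}
    (h : IsChart L i₀ col) (hr : 0 < r) {l : ι ⊕ κ} (hl : l ∈ L) {z : Fin r → ι ⊕ κ → ℝ}
    (hb : ∀ i, Balanced (z i)) (hs : ∀ i, SupportedIn L (z i)) (h0 : ∀ i, z i l = 0) :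
    coordDet col z = 0 := by
  obtain ⟨ξ, hξ, H⟩ := h.exists_functional hr hl
  exact coordDet_eq_zero_of_functional hξ fun i => by rw [← H _ (hb i) (hs i), h0]

lemma coordDet_comp_perm {l : Type*} (col : Fin r → l) (z : Fin r → l → ℝ)
    (π : Equiv.Perm (Fin r)) :
    coordDet col (z ∘ π) = ((Equiv.Perm.sign π : ℤ) : ℝ) * coordDet col z :=
  Matrix.det_permute π (Matrix.of fun i c => z i (col c))

/-- The determinant is linear in its first vector. -/
lemma exists_coordDet_cons_eq {l : Type*} (col : Fin (r + 1) → l) (z : Fin r → l → ℝ) :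
    ∃ c : Fin (r + 1) → ℝ, ∀ y, coordDet col (Fin.cons y z) = ∑ k, c k * y (col k) := by
  refine ⟨fun k => (-1) ^ (k : ℕ) *
    (Matrix.of fun (i : Fin r) (c : Fin r) => z i (col (k.succAbove c))).det, fun y => ?_⟩
  rw [coordDet, Matrix.det_succ_row_zero]
  refine Finset.sum_congr rfl fun k _ => ?_
  simp only [Matrix.of_apply, Fin.cons_zero]
  rw [mul_right_comm]
  rfl

/-- Expansion along a column that vanishes except in the first row. -/
lemma coordDet_cons_of_eq_zero {l : Type*} (col : Fin (r + 1) → l) (z : Fin r → l → ℝ)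
    (y : l → ℝ) (c : Fin (r + 1)) (h : ∀ i, z i (col c) = 0) :
    coordDet col (Fin.cons y z) =
      (-1) ^ (c : ℕ) * y (col c) * coordDet (col ∘ c.succAbove) z := by
  rw [coordDet, Matrix.det_succ_column _ c, Fin.sum_univ_succ, Finset.sum_eq_zero, add_zero]
  · simp only [Matrix.of_apply, Fin.cons_zero, Fin.val_zero, zero_add]
    rfl
  · intro i _
    simp [h]

/-- This is Cramer's rule for expressing `w` through the `z i`, paired with the functional `ξ` and
cleared of denominators. The adjugate makes it valid for degenerate `z` as well. -/
lemma coordDet_sum_update {l : Type*} (col : Fin r → l) (z : Fin r → l → ℝ) (ξ : Fin r → ℝ)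
    (w : l → ℝ) :
    ∑ i, (∑ c, z i (col c) * ξ c) * coordDet col (Function.update z i w) =
      (∑ c, w (col c) * ξ c) * coordDet col z := by
  set M : Matrix (Fin r) (Fin r) ℝ := Matrix.of fun i c => z i (col c) with hM
  have hu : ∀ i, coordDet col (Function.update z i w) = (M.updateRow i (w ∘ col)).det := by
    intro i
    rw [coordDet]; congr 1
    ext a b
    by_cases hab : a = i
    · subst hab; simp
    · simp [hab, hM]
  have : ∀ i, (M.updateRow i (w ∘ col)).det = (Matrix.adjugate M.transpose).mulVec (w ∘ col) i := by
    intro i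
    rw [← Matrix.cramer_transpose_apply, Matrix.cramer_eq_adjugate_mulVec]
  simp only [hu, this]
  have h1 : ∑ i, (∑ c, z i (col c) * ξ c) * (Matrix.adjugate M.transpose).mulVec (w ∘ col) i
      = (M.mulVec ξ) ⬝ᵥ ((Matrix.adjugate M.transpose).mulVec (w ∘ col)) := rfl
  rw [h1, ← Matrix.adjugate_transpose, Matrix.mulVec_transpose, dotProduct_comm,
    ← Matrix.dotProduct_mulVec, Matrix.mulVec_mulVec, Matrix.adjugate_mul, Matrix.smul_mulVec,
    Matrix.one_mulVec, dotProduct_smul, smul_eq_mul, mul_comm]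
  rfl

end Coordinates

/-! ### Simplicial fans and the simplices around a facet -/

section Fan

variable {ι κ X : Type*} [Fintype ι] [Fintype κ] [DecidableEq ι] [DecidableEq κ]
  [Fintype X] [DecidableEq X] {r : ℕ}

/-- The cones spanned by the vectors `Φ x`, for `x` in a member of `T`, form a simplicial
fan that subdivides the cone of nonnegative balanced vectors: each of these vectors is a
nonnegative combination of the rays of some cone, in a unique way. -/
structure IsFan (T : Set (Finset X)) (Φ : X → ι ⊕ κ → ℝ) : Prop where
  empty_mem : ∅ ∈ T
  down : ∀ ⦃σ ρ⦄, σ ∈ T → ρ ⊆ σ → ρ ∈ T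
  nonneg : ∀ x, 0 ≤ Φ x
  balanced : ∀ x, Balanced (Φ x)
  unique : ∀ ⦃σ τ⦄, σ ∈ T → τ ∈ T → ∀ s t : X → ℝ, 0 ≤ s → 0 ≤ t → (∀ x ∉ σ, s x = 0) →
    (∀ x ∉ τ, t x = 0) → ∑ x, s x • Φ x = ∑ x, t x • Φ x → s = t
  cover : ∀ z, 0 ≤ z → Balanced z →
    ∃ σ ∈ T, ∃ t : X → ℝ, 0 ≤ t ∧ (∀ x ∉ σ, t x = 0) ∧ z = ∑ x, t x • Φ x

/-- The tuple `v` lists vertices of a cone of `T`, all lying in the face `L`. -/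
def Admissible (T : Set (Finset X)) (Φ : X → ι ⊕ κ → ℝ) (L : Finset (ι ⊕ κ)) (v : Fin r → X) :
    Prop :=
  Finset.univ.image v ∈ T ∧ ∀ i, SupportedIn L (Φ (v i))

variable {T : Set (Finset X)} {Φ : X → ι ⊕ κ → ℝ} {L : Finset (ι ⊕ κ)} {i₀ : ι}

lemma image_cons (a : X) (v : Fin r → X) :
    Finset.univ.image (Fin.cons a v : Fin (r + 1) → X) = insert a (Finset.univ.image v) := by
  ext x
  simp [Fin.exists_fin_succ, eq_comm]

lemma comp_cons {α β : Type*} (f : α → β) (a : α) (v : Fin r → α) :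
    (fun i => f ((Fin.cons a v : Fin (r + 1) → α) i)) = Fin.cons (f a) fun i => f (v i) := by
  funext i
  refine Fin.cases ?_ (fun i => ?_) i <;> simp

lemma coordDet_eq_zero_of_eq {l : Type*} (col : Fin r → l) {z : Fin r → l → ℝ} {i j : Fin r}
    (hij : i ≠ j) (h : z i = z j) : coordDet col z = 0 :=
  Matrix.det_zero_of_row_eq hij (by funext c; simp [h])

lemma coordDet_cons_eq_zero_of_mem {l : Type*} (col : Fin (r + 1) → l) (z : Fin r → l → ℝ)
    (i : Fin r) : coordDet col (Fin.cons (z i) z) = 0 :=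
  coordDet_eq_zero_of_eq col (i := 0) (j := i.succ) (Fin.succ_ne_zero i).symm (by simp)

/-- The weights `c i` placed on the points `v i`. -/
noncomputable def tupleWeight (v : Fin r → X) (c : Fin r → ℝ) : X → ℝ :=
  ∑ i, c i • Pi.single (v i) 1

lemma tupleWeight_apply (v : Fin r → X) (c : Fin r → ℝ) (x : X) :
    tupleWeight v c x = ∑ i, if x = v i then c i else 0 := by
  simp [tupleWeight, Pi.single_apply]

lemma tupleWeight_nonneg (v : Fin r → X) {c : Fin r → ℝ} (hc : 0 ≤ c) :
    0 ≤ tupleWeight v c := fun x => by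
  rw [tupleWeight_apply]
  exact Finset.sum_nonneg fun i _ => by split_ifs; exacts [hc i, le_rfl]

lemma le_tupleWeight (v : Fin r → X) {c : Fin r → ℝ} (hc : 0 ≤ c) (i : Fin r) :
    c i ≤ tupleWeight v c (v i) := by
  rw [tupleWeight_apply]
  refine le_trans (le_of_eq ?_) (Finset.single_le_sum (f := fun k => if v i = v k then c k else 0)
    (fun k _ => ?_) (Finset.mem_univ i))
  · simp
  · split_ifs; exacts [hc k, le_rfl]

lemma tupleWeight_eq_zero (v : Fin r → X) (c : Fin r → ℝ) :
    ∀ x ∉ Finset.univ.image v, tupleWeight v c x = 0 := fun x hx => by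
  rw [tupleWeight_apply]
  refine Finset.sum_eq_zero fun i _ => if_neg fun h => hx ?_
  exact Finset.mem_image.2 ⟨i, Finset.mem_univ _, h.symm⟩

lemma sum_tupleWeight_smul (v : Fin r → X) (c : Fin r → ℝ) (Φ : X → ι ⊕ κ → ℝ) :
    ∑ x, tupleWeight v c x • Φ x = ∑ i, c i • Φ (v i) := by
  simp only [tupleWeight_apply, Finset.sum_smul]
  rw [Finset.sum_comm]
  simp [ite_smul]

/-- Two simplices with a common facet and on the same side of it coincide. -/
lemma IsFan.eq_of_same_side (hF : IsFan T Φ) {col : Fin (r + 1) → ι ⊕ κ}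
    (hcol : IsChart L i₀ col) {v : Fin r → X} {a b : X}
    (ha : Admissible T Φ L (Fin.cons a v : Fin (r + 1) → X))
    (hb : Admissible T Φ L (Fin.cons b v : Fin (r + 1) → X))
    (hab : 0 < coordDet col (Fin.cons (Φ a) fun i => Φ (v i)) *
      coordDet col (Fin.cons (Φ b) fun i => Φ (v i))) : a = b := by
  obtain ⟨ℓ, hℓ⟩ := exists_coordDet_cons_eq col fun i => Φ (v i)
  set A := coordDet col (Fin.cons (Φ a) fun i => Φ (v i)) with hA
  set B := coordDet col (Fin.cons (Φ b) fun i => Φ (v i)) with hB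
  have hA0 : A ≠ 0 := left_ne_zero_of_mul hab.ne'
  have hB0 : B ≠ 0 := right_ne_zero_of_mul hab.ne'
  -- The determinants `A` and `B` have the same sign, so this combination has zero determinant and
  -- lies in the span of the common facet.
  set y : ι ⊕ κ → ℝ := |A| • Φ b + (-|B|) • Φ a with hy
  have hsa : SupportedIn L (Φ a) := by simpa using ha.2 0
  have hsb : SupportedIn L (Φ b) := by simpa using hb.2 0
  have hsv : ∀ i, SupportedIn L (Φ (v i)) := fun i => by simpa using ha.2 i.succ
  have hdet : coordDet col (Fin.cons y fun i => Φ (v i)) = 0 := by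
    have h1 : coordDet col (Fin.cons y fun i => Φ (v i)) = |A| * B - |B| * A := by
      rw [hA, hB, hℓ, hℓ, hℓ]
      simp only [hy, Pi.add_apply, Pi.smul_apply, smul_eq_mul, Finset.mul_sum,
        ← Finset.sum_sub_distrib]
      rw [← hℓ, ← hℓ]
      exact Finset.sum_congr rfl fun k _ => by ring
    rw [h1]
    rcases pos_and_pos_or_neg_and_neg_of_mul_pos hab with ⟨h, h'⟩ | ⟨h, h'⟩
    · rw [abs_of_pos h, abs_of_pos h']; ring
    · rw [abs_of_neg h, abs_of_neg h']; ring
  have hli : LinearIndependent ℝ (Matrix.of fun i c =>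
      (Fin.cons (Φ a) fun i => Φ (v i) : Fin (r + 1) → ι ⊕ κ → ℝ) i (col c)).row :=
    Matrix.linearIndependent_rows_iff_isUnit.2 ((Matrix.isUnit_iff_isUnit_det _).2
      (isUnit_iff_ne_zero.2 hA0))
  have hcons : ∀ y : ι ⊕ κ → ℝ, (Matrix.of fun i c =>
      (Fin.cons y fun i => Φ (v i) : Fin (r + 1) → ι ⊕ κ → ℝ) i (col c)).row =
      Fin.cons (y ∘ col) (fun i => Φ (v i) ∘ col) := by
    intro y
    funext i
    refine Fin.cases ?_ (fun i => ?_) i <;> rfl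
  rw [hcons, linearIndependent_finCons] at hli
  have hmem : y ∘ col ∈ Submodule.span ℝ (Set.range fun i => Φ (v i) ∘ col) := by
    by_contra hn
    have := linearIndependent_finCons.2 ⟨hli.1, hn⟩
    rw [← hcons, Matrix.linearIndependent_rows_iff_isUnit, Matrix.isUnit_iff_isUnit_det] at this
    exact this.ne_zero hdet
  obtain ⟨c, hc⟩ := (Submodule.mem_span_range_iff_exists_fun ℝ).1 hmem
  have hy0 : y + ∑ i, (-c i) • Φ (v i) = 0 := by
    refine hcol.eq_zero ?_ ?_ fun k => ?_
    · exact (((hF.balanced b).smul _).add ((hF.balanced a).smul _)).add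
        (Balanced.sum _ fun i => (hF.balanced _).smul _)
    · exact ((hsb.smul _).add (hsa.smul _)).add (SupportedIn.sum _ fun i => (hsv i).smul _)
    · have := congrFun hc k
      simp only [Finset.sum_apply, Pi.smul_apply, Function.comp_apply, smul_eq_mul] at this
      simp [Finset.sum_apply, ← this]
  by_contra hne
  -- Moving the negative coefficients to the other side leaves two nonnegative representations of
  -- one vector, over the two simplices. The vertex `b` has weight at least `|A|` in one and weight
  -- zero in the other.
  have hs : (0 : Fin (r + 1) → ℝ) ≤ Fin.cons |A| fun i => max (-c i) 0 := fun i =>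
    Fin.cases (by simp) (fun i => by simp) i
  have ht : (0 : Fin (r + 1) → ℝ) ≤ Fin.cons |B| fun i => max (c i) 0 := fun i =>
    Fin.cases (by simp) (fun i => by simp) i
  have key := hF.unique hb.1 ha.1 _ _ (tupleWeight_nonneg _ hs) (tupleWeight_nonneg _ ht)
    (tupleWeight_eq_zero _ _) (tupleWeight_eq_zero _ _) (by
      rw [sum_tupleWeight_smul, sum_tupleWeight_smul, Fin.sum_univ_succ, Fin.sum_univ_succ]
      simp only [Fin.cons_zero, Fin.cons_succ]
      have h2 : ∑ i, max (-c i) 0 • Φ (v i) =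
          ∑ i, max (c i) 0 • Φ (v i) + ∑ i, (-c i) • Φ (v i) := by
        rw [← Finset.sum_add_distrib]
        refine Finset.sum_congr rfl fun i _ => ?_
        rw [← add_smul]; congr 1
        rcases le_total (c i) 0 with h | h
        · rw [max_eq_left (by linarith), max_eq_right h]; ring
        · rw [max_eq_right (by linarith), max_eq_left h]; ring
      have h3 : |A| • Φ b = y + |B| • Φ a := by rw [hy]; module
      rw [h2, h3]
      calc _ = |B| • Φ a + ∑ i, max (c i) 0 • Φ (v i) + (y + ∑ i, (-c i) • Φ (v i)) := by abel
        _ = _ := by rw [hy0, add_zero])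
  have h1 := le_tupleWeight (Fin.cons b v : Fin (r + 1) → X) hs 0
  rw [key, Fin.cons_zero, Fin.cons_zero, tupleWeight_eq_zero] at h1
  · exact absurd h1 (not_le.2 (abs_pos.2 hA0))
  · rw [image_cons, Finset.mem_insert, not_or]
    refine ⟨fun h => hne h.symm, fun h => ?_⟩
    obtain ⟨i, -, rfl⟩ := Finset.mem_image.1 h
    exact hB0 (coordDet_cons_eq_zero_of_mem col (fun i => Φ (v i)) i)

/-- The rays of a cone of a fan are linearly independent. -/
lemma IsFan.unique_signed (hF : IsFan T Φ) {σ : Finset X} (hσ : σ ∈ T) {s t : X → ℝ}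
    (hs : ∀ x ∉ σ, s x = 0) (ht : ∀ x ∉ σ, t x = 0)
    (h : ∑ x, s x • Φ x = ∑ x, t x • Φ x) : s = t := by
  -- Adding `|s| + |t|` to both weights makes them nonnegative without changing their difference.
  set u : X → ℝ := fun x => |s x| + |t x| with hu
  have h0 : s + u = t + u := by
    refine hF.unique hσ hσ _ _ (fun x => ?_) (fun x => ?_) (fun x hx => ?_) (fun x hx => ?_) ?_
    · have := neg_abs_le (s x); have := abs_nonneg (t x)
      simp only [hu, Pi.zero_apply, Pi.add_apply]; linarith
    · have := neg_abs_le (t x); have := abs_nonneg (s x)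
      simp only [hu, Pi.zero_apply, Pi.add_apply]; linarith
    · simp [hu, hs x hx, ht x hx]
    · simp [hu, hs x hx, ht x hx]
    · simp only [Pi.add_apply, add_smul, Finset.sum_add_distrib, h]
  exact add_right_cancel h0

open Filter Topology in
/-- If one can move from the relative interior of a simplex into the direction `y` without
leaving the cone, then there is a simplex on the side of `y` with the given one as a facet. -/
lemma IsFan.exists_side (hF : IsFan T Φ) {col : Fin (r + 1) → ι ⊕ κ} {v : Fin r → X}
    (hv : Admissible T Φ L v) {y : ι ⊕ κ → ℝ} (hyb : Balanced y) (hys : SupportedIn L y)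
    (hy : coordDet col (Fin.cons y fun i => Φ (v i)) ≠ 0)
    (hpos : ∀ᶠ ε in 𝓝[>] (0 : ℝ), 0 ≤ ∑ i, Φ (v i) + ε • y) :
    ∃ a, Admissible T Φ L (Fin.cons a v : Fin (r + 1) → X) ∧
      0 < coordDet col (Fin.cons (Φ a) fun i => Φ (v i)) *
        coordDet col (Fin.cons y fun i => Φ (v i)) := by
  obtain ⟨ℓ, hℓ⟩ := exists_coordDet_cons_eq col fun i => Φ (v i)
  set z := ∑ i, Φ (v i) with hz
  have hzb : Balanced z := Balanced.sum _ fun i => hF.balanced _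
  have hzs : SupportedIn L z := SupportedIn.sum _ hv.2
  have hfreq : ∃ᶠ ε in 𝓝[>] (0 : ℝ), ∃ σ : Finset X, σ ∈ T ∧ ∃ t : X → ℝ, 0 ≤ t ∧
      (∀ x ∉ σ, t x = 0) ∧ z + ε • y = ∑ x, t x • Φ x :=
    (hpos.mono fun ε hε => hF.cover _ hε (hzb.add (hyb.smul ε))).frequently
  -- There are finitely many simplices, so a single one contains `z + ε • y` for arbitrarily small
  -- `ε > 0`.
  obtain ⟨σ, hσ⟩ := frequently_exists.1 hfreq
  obtain ⟨ε₂, ⟨hσT, t₂, ht₂, hs₂, he₂⟩, hε₂⟩ := (hσ.and_eventually self_mem_nhdsWithin).exists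
  obtain ⟨ε₁, ⟨-, t₁, ht₁, hs₁, he₁⟩, hε₁⟩ :=
    (hσ.and_eventually (Ioo_mem_nhdsGT hε₂)).exists
  have hd : ε₂ - ε₁ ≠ 0 := (sub_pos.2 hε₁.2).ne'
  -- Interpolation between two such values of `ε` gives weights `α` of `z` and `β` of `y` on `σ`.
  set β : X → ℝ := (ε₂ - ε₁)⁻¹ • (t₂ - t₁) with hβ
  set α : X → ℝ := t₁ - ε₁ • β with hα
  have hβs : ∀ x ∉ σ, β x = 0 := fun x hx => by simp [hβ, hs₁ x hx, hs₂ x hx]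
  have hαs : ∀ x ∉ σ, α x = 0 := fun x hx => by simp [hα, hs₁ x hx, hβs x hx]
  have hyβ : y = ∑ x, β x • Φ x := by
    have h1 : ∑ x, β x • Φ x = (ε₂ - ε₁)⁻¹ • (∑ x, t₂ x • Φ x - ∑ x, t₁ x • Φ x) := by
      rw [← Finset.sum_sub_distrib, Finset.smul_sum]
      exact Finset.sum_congr rfl fun x _ => by
        simp only [hβ, Pi.smul_apply, Pi.sub_apply, smul_eq_mul, mul_smul, sub_smul, smul_sub]
    rw [h1, ← he₁, ← he₂, add_sub_add_left_eq_sub, ← sub_smul, smul_smul, inv_mul_cancel₀ hd,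
      one_smul]
  have hzα : z = ∑ x, α x • Φ x := by
    have h1 : ∑ x, α x • Φ x = ∑ x, t₁ x • Φ x - ε₁ • ∑ x, β x • Φ x := by
      rw [Finset.smul_sum, ← Finset.sum_sub_distrib]
      exact Finset.sum_congr rfl fun x _ => by
        simp only [hα, Pi.smul_apply, Pi.sub_apply, smul_eq_mul, mul_smul, sub_smul]
    rw [h1, ← he₁, ← hyβ, add_sub_cancel_right]
  -- By linear independence the weights of `z + ε • y` on `σ` are `α + ε • β`. They are nonnegative
  -- for arbitrarily small `ε`, hence so is their limit `α`.
  have hα0 : 0 ≤ α := by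
    intro x
    by_contra hx
    have hx : α x < 0 := not_le.1 hx
    have hlim : Tendsto (fun ε : ℝ => α x + ε * β x) (𝓝[>] 0) (𝓝 (α x)) := by
      have : Continuous fun ε : ℝ => α x + ε * β x := by fun_prop
      simpa using (this.tendsto 0).mono_left nhdsWithin_le_nhds
    obtain ⟨ε, ⟨-, t, ht, hs, he⟩, hneg⟩ :=
      (hσ.and_eventually (hlim.eventually (gt_mem_nhds hx))).exists
    have : t = α + ε • β := by
      refine hF.unique_signed hσT hs (fun x hx => by simp [hαs x hx, hβs x hx]) ?_
      rw [← he, hzα]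
      nth_rw 1 [hyβ]
      rw [Finset.smul_sum, ← Finset.sum_add_distrib]
      exact Finset.sum_congr rfl fun x _ => by
        simp only [Pi.smul_apply, Pi.add_apply, smul_eq_mul, mul_smul, add_smul]
    have h2 := ht x
    rw [this] at h2
    simp only [Pi.zero_apply, Pi.add_apply, Pi.smul_apply, smul_eq_mul] at h2
    linarith
  have hαv : α = tupleWeight v 1 := by
    refine hF.unique hσT hv.1 _ _ hα0 (tupleWeight_nonneg v zero_le_one) hαs
      (tupleWeight_eq_zero _ _) ?_
    rw [sum_tupleWeight_smul, ← hzα]; simp [hz]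
  have hvσ : Finset.univ.image v ⊆ σ := by
    intro x hx
    obtain ⟨i, -, rfl⟩ := Finset.mem_image.1 hx
    by_contra hn
    have := le_tupleWeight v (c := 1) zero_le_one i
    rw [← hαv, hαs _ hn] at this
    exact absurd this (by simp)
  have hsum : coordDet col (Fin.cons y fun i => Φ (v i)) =
      ∑ x, β x * coordDet col (Fin.cons (Φ x) fun i => Φ (v i)) := by
    simp only [hℓ, Finset.mul_sum]
    rw [Finset.sum_comm]
    refine Finset.sum_congr rfl fun k _ => ?_
    nth_rw 1 [hyβ]
    simp only [Finset.sum_apply, Pi.smul_apply, smul_eq_mul, Finset.mul_sum]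
    exact Finset.sum_congr rfl fun x _ => by ring
  set D := coordDet col (Fin.cons y fun i => Φ (v i)) with hD
  -- Expanding one factor of `D * D > 0` through the weights `β` leaves at least one positive term,
  -- which provides the new vertex.
  obtain ⟨x, -, hx⟩ : ∃ x ∈ Finset.univ,
      0 < β x * coordDet col (Fin.cons (Φ x) fun i => Φ (v i)) * D := by
    apply Finset.exists_lt_of_sum_lt (f := fun _ => (0 : ℝ))
    rw [← Finset.sum_mul, ← hsum, Finset.sum_const_zero]
    exact mul_self_pos.2 hy
  have hxv : x ∉ Finset.univ.image v := by
    intro h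
    obtain ⟨i, -, rfl⟩ := Finset.mem_image.1 h
    rw [coordDet_cons_eq_zero_of_mem col (fun i => Φ (v i)) i] at hx
    simp at hx
  -- Outside the facet `α` vanishes, so the nonnegative weight of `x` is `ε₁ * β x`. Hence `β x` is
  -- positive and `x` lies on the side of `y`.
  have hαx : α x = 0 := by rw [hαv, tupleWeight_eq_zero _ _ x hxv]
  have ht₁x : t₁ x = ε₁ * β x := by
    have : α x = t₁ x - ε₁ * β x := rfl
    linarith
  have hβ0 : β x ≠ 0 := fun h => by simp [h] at hx
  have hβx : 0 < β x := by
    refine lt_of_le_of_ne ?_ hβ0.symm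
    have := ht₁ x
    rw [ht₁x] at this
    exact nonneg_of_mul_nonneg_right this hε₁.1
  refine ⟨x, ⟨?_, ?_⟩, ?_⟩
  · rw [image_cons]
    refine hF.down hσT (Finset.insert_subset ?_ hvσ)
    by_contra hn
    exact hβ0 (hβs x hn)
  · refine fun i => Fin.cases ?_ (fun i => by simpa using hv.2 i) i
    intro l hl
    -- A nonnegative combination lying in the face `L` forces every vertex of positive weight into
    -- `L`.
    have h1 : (z + ε₁ • y) l = 0 := (hzs.add (hys.smul _)) l hl
    rw [he₁, Finset.sum_apply] at h1
    have h2 := (Finset.sum_eq_zero_iff_of_nonneg fun x _ =>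
      mul_nonneg (ht₁ x) (hF.nonneg x l)).1 h1 x (Finset.mem_univ x)
    exact (mul_eq_zero.1 h2).resolve_left (by rw [ht₁x]; exact (mul_pos hε₁.1 hβx).ne')
  · rw [mul_assoc] at hx
    exact (mul_pos_iff_of_pos_left hβx).1 hx

end Fan

/-! ### Signed number of simplices containing a given facet -/

section Count

variable {ι κ X : Type*} [Fintype ι] [Fintype κ] [DecidableEq ι] [DecidableEq κ]
  [Fintype X] [DecidableEq X] {r : ℕ}
  {T : Set (Finset X)} {Φ : X → ι ⊕ κ → ℝ} {L : Finset (ι ⊕ κ)} {i₀ : ι}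

/-- The orientation of the vectors `z i` in the coordinates `col c`. -/
noncomputable def orient {l : Type*} (col : Fin r → l) (z : Fin r → l → ℝ) : ℝ :=
  (SignType.sign (coordDet col z) : SignType)

lemma orient_eq_zero {l : Type*} {col : Fin r → l} {z : Fin r → l → ℝ}
    (h : coordDet col z = 0) : orient col z = 0 := by simp [orient, h]

lemma orient_eq_of_mul_pos {l : Type*} {col : Fin r → l} {y z : Fin r → l → ℝ}
    (h : 0 < coordDet col y * coordDet col z) : orient col y = orient col z := by
  rcases pos_and_pos_or_neg_and_neg_of_mul_pos h with ⟨h1, h2⟩ | ⟨h1, h2⟩ <;>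
    simp [orient, h1, h2]

lemma orient_comp_perm {l : Type*} (col : Fin r → l) (z : Fin r → l → ℝ)
    (π : Equiv.Perm (Fin r)) :
    orient col (z ∘ π) = ((Equiv.Perm.sign π : ℤ) : ℝ) * orient col z := by
  rw [orient, orient, coordDet_comp_perm]
  rcases Int.units_eq_one_or (Equiv.Perm.sign π) with h | h <;> simp [h, Left.sign_neg]

open Classical in
/-- The sum of the orientations of the simplices that contain a given one as a facet. -/
noncomputable def linkSum (T : Set (Finset X)) (Φ : X → ι ⊕ κ → ℝ) (L : Finset (ι ⊕ κ))
    (col : Fin (r + 1) → ι ⊕ κ) (v : Fin r → X) : ℝ :=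
  ∑ a, if Admissible T Φ L (Fin.cons a v : Fin (r + 1) → X) then
    orient col (Fin.cons (Φ a) fun i => Φ (v i)) else 0

/-- The determinant obtained by adding `y` is a fixed multiple of `y (col c)`, and this coordinate
is nonnegative on the cone. All nondegenerate extensions therefore lie on one side, the side of `w`,
where there is exactly one. -/
lemma IsFan.linkSum_of_mem_facet (hF : IsFan T Φ) {col : Fin (r + 1) → ι ⊕ κ}
    (hcol : IsChart L i₀ col) {v : Fin r → X} (hv : Admissible T Φ L v) (c : Fin (r + 1))
    (hc : ∀ i, Φ (v i) (col c) = 0) {w : ι ⊕ κ → ℝ} (hw : 0 ≤ w) (hwb : Balanced w)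
    (hws : SupportedIn L w) (hwc : 0 < w (col c)) :
    linkSum T Φ L col v = orient col (Fin.cons w fun i => Φ (v i)) := by
  classical
  have hD := fun y => coordDet_cons_of_eq_zero col (fun i => Φ (v i)) y c hc
  set δ := coordDet (col ∘ c.succAbove) fun i => Φ (v i)
  by_cases hδ : δ = 0
  · rw [orient_eq_zero (by rw [hD, hδ, mul_zero]), linkSum]
    refine Finset.sum_eq_zero fun a _ => ?_
    rw [orient_eq_zero (by rw [hD, hδ, mul_zero]), ite_self]
  have hsq : ((-1 : ℝ) ^ (c : ℕ)) * (-1) ^ (c : ℕ) = 1 := by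
    rw [← mul_pow]; norm_num
  obtain ⟨a, ha, haw⟩ := hF.exists_side (col := col) hv hwb hws
    (by rw [hD]; exact mul_ne_zero (mul_ne_zero (pow_ne_zero _ (by norm_num)) hwc.ne') hδ)
    (Filter.eventually_of_mem self_mem_nhdsWithin fun ε (hε : 0 < ε) =>
      add_nonneg (Finset.sum_nonneg fun i _ => hF.nonneg _) (smul_nonneg hε.le hw))
  rw [← orient_eq_of_mul_pos haw, linkSum]
  rw [Fintype.sum_eq_single a, if_pos ha]
  intro b hba
  by_cases hb : Admissible T Φ L (Fin.cons b v : Fin (r + 1) → X)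
  · rw [if_pos hb]
    refine orient_eq_zero ?_
    by_contra hb0
    refine hba (hF.eq_of_same_side hcol hb ha ?_)
    -- A nondegenerate extension must leave the boundary facet, and nonnegativity leaves only the
    -- positive direction.
    have hbc : 0 < Φ b (col c) := lt_of_le_of_ne (hF.nonneg b _) fun h => hb0 (by
      rw [hD, ← h]; simp)
    have hac : 0 < Φ a (col c) := lt_of_le_of_ne (hF.nonneg a _) fun h => haw.ne (by
      rw [hD (Φ a), ← h]; simp)
    rw [hD, hD]
    calc (0 : ℝ) < Φ b (col c) * Φ a (col c) * (δ * δ) :=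
          mul_pos (mul_pos hbc hac) (mul_self_pos.2 hδ)
      _ = ((-1 : ℝ) ^ (c : ℕ) * (-1) ^ (c : ℕ)) * (Φ b (col c) * Φ a (col c) * (δ * δ)) := by
          rw [hsq, one_mul]
      _ = _ := by ring
  · exact if_neg hb

-- The sum of the facet's vectors is positive in all coordinates of `L`, so one can move from it in
-- either direction transverse to the facet. Each side carries exactly one nondegenerate simplex,
-- and the two orientations cancel. If no transverse direction exists, every term is already zero.
open Filter Topology in
lemma IsFan.linkSum_of_interior (hF : IsFan T Φ) {col : Fin (r + 1) → ι ⊕ κ}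
    (hcol : IsChart L i₀ col) {v : Fin r → X} (hv : Admissible T Φ L v)
    (hint : ∀ l ∈ L, ∃ i, Φ (v i) l ≠ 0) : linkSum T Φ L col v = 0 := by
  classical
  by_cases hy : ∃ y, Balanced y ∧ SupportedIn L y ∧
      coordDet col (Fin.cons y fun i => Φ (v i)) ≠ 0
  swap
  · push Not at hy
    refine Finset.sum_eq_zero fun a _ => ?_
    split_ifs with h
    · exact orient_eq_zero (hy _ (hF.balanced a) (by simpa using h.2 0))
    · rfl
  obtain ⟨y, hyb, hys, hy⟩ := hy
  have hev : ∀ y : ι ⊕ κ → ℝ, SupportedIn L y →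
      ∀ᶠ ε in 𝓝[>] (0 : ℝ), 0 ≤ ∑ i, Φ (v i) + ε • y := by
    intro y hys
    have : ∀ l, ∀ᶠ ε in 𝓝[>] (0 : ℝ), 0 ≤ (∑ i, Φ (v i) + ε • y) l := by
      intro l
      by_cases hl : l ∈ L
      · obtain ⟨i, hi⟩ := hint l hl
        have hpos : 0 < (∑ i, Φ (v i)) l := by
          rw [Finset.sum_apply]
          exact Finset.sum_pos' (fun i _ => hF.nonneg _ _)
            ⟨i, Finset.mem_univ _, lt_of_le_of_ne (hF.nonneg _ _) hi.symm⟩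
        have hlim : Tendsto (fun ε : ℝ => (∑ i, Φ (v i) + ε • y) l) (𝓝[>] 0)
            (𝓝 ((∑ i, Φ (v i)) l)) := by
          have : Continuous fun ε : ℝ => (∑ i, Φ (v i) + ε • y) l := by
            simp only [Pi.add_apply, Pi.smul_apply]; fun_prop
          simpa using (this.tendsto 0).mono_left nhdsWithin_le_nhds
        exact (hlim.eventually (lt_mem_nhds hpos)).mono fun ε h => h.le
      · refine Eventually.of_forall fun ε => ?_
        rw [((SupportedIn.sum _ hv.2).add (hys.smul ε)) l hl]
    exact (eventually_all.2 this).mono fun ε h l => h l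
  have hneg : coordDet col (Fin.cons (-y) fun i => Φ (v i)) =
      - coordDet col (Fin.cons y fun i => Φ (v i)) := by
    obtain ⟨ℓ, hℓ⟩ := exists_coordDet_cons_eq col fun i => Φ (v i)
    simp [hℓ]
  obtain ⟨a, ha, hay⟩ := hF.exists_side (col := col) hv hyb hys hy (hev y hys)
  obtain ⟨b, hb, hby⟩ := hF.exists_side (col := col) hv (y := -y)
    (by simpa using hyb.smul (-1)) (by simpa using hys.smul (-1))
    (by rw [hneg]; exact neg_ne_zero.2 hy) (hev _ (by simpa using hys.smul (-1)))
  rw [hneg] at hby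
  have hab : a ≠ b := by
    rintro rfl
    have := add_pos hay hby
    simp at this
  rw [linkSum, Fintype.sum_eq_add a b hab, if_pos ha, if_pos hb]
  · have h1 := orient_eq_of_mul_pos hay
    rw [h1]
    rcases lt_or_gt_of_ne hy with h | h
    · have h2 : 0 < coordDet col (Fin.cons (Φ b) fun i => Φ (v i)) :=
        (pos_iff_pos_of_mul_pos hby).2 (neg_pos.2 h)
      simp [orient, h, h2]
    · have h2 : coordDet col (Fin.cons (Φ b) fun i => Φ (v i)) < 0 :=
        (neg_iff_neg_of_mul_pos hby).2 (neg_lt_zero.2 h)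
      simp [orient, h, h2]
  · rintro x ⟨hxa, hxb⟩
    split_ifs with hx
    · refine orient_eq_zero ?_
      by_contra h0
      rcases lt_or_gt_of_ne (mul_ne_zero h0 hy) with h | h
      · refine hxb (hF.eq_of_same_side hcol hx hb ?_)
        have h3 := mul_pos (neg_pos.2 h) hby
        have h4 := mul_self_pos.2 hy
        refine (mul_pos_iff_of_pos_right h4).1 ?_
        linarith
      · refine hxa (hF.eq_of_same_side hcol hx ha ?_)
        have h3 := mul_pos h hay
        have h4 := mul_self_pos.2 hy
        refine (mul_pos_iff_of_pos_right h4).1 ?_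
        linarith
    · rfl

end Count

/-! ### The determinant cochain of a type, and the total signed count -/

section Weight

variable {ι κ X : Type*} [Fintype ι] [Fintype κ] [DecidableEq ι] [DecidableEq κ]
  [Fintype X] [DecidableEq X] {r : ℕ}
  {T : Set (Finset X)} {Φ : X → ι ⊕ κ → ℝ} {L : Finset (ι ⊕ κ)} {i₀ : ι}

/-- The number of members of a tuple of vertices that project to the vertex `j` of the second
factor. -/
def typeCount (y : Fin r → ι × κ) (j : κ) : ℕ := ∑ i, if (y i).2 = j then 1 else 0

/-- The determinant of a tuple of vertices if the tuple has type `k`, and `0` otherwise. -/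
noncomputable def typeDet (k : κ → ℕ) (col : Fin r → ι ⊕ κ) (y : Fin r → ι × κ) : ℝ :=
  if ∀ j, typeCount y j = k j then coordDet col (fun i => vertexVector (y i)) else 0

lemma typeDet_eq_zero {k : κ → ℕ} {col : Fin r → ι ⊕ κ} {y : Fin r → ι × κ}
    (h : coordDet col (fun i => vertexVector (y i)) = 0) : typeDet k col y = 0 := by
  rw [typeDet, h, ite_self]

lemma typeCount_comp_perm (y : Fin r → ι × κ) (π : Equiv.Perm (Fin r)) (j : κ) :
    typeCount (y ∘ π) j = typeCount y j :=
  Equiv.sum_comp π fun i => if (y i).2 = j then 1 else 0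

lemma typeDet_comp_perm (k : κ → ℕ) (col : Fin r → ι ⊕ κ) (y : Fin r → ι × κ)
    (π : Equiv.Perm (Fin r)) :
    typeDet k col (y ∘ π) = ((Equiv.Perm.sign π : ℤ) : ℝ) * typeDet k col y := by
  simp only [typeDet, typeCount_comp_perm, mul_ite, mul_zero]
  rw [← coordDet_comp_perm]
  rfl

lemma typeCount_cons (w : ι × κ) (y : Fin r → ι × κ) (j : κ) :
    typeCount (Fin.cons w y : Fin (r + 1) → ι × κ) j =
      (if w.2 = j then 1 else 0) + typeCount y j := by
  simp only [typeCount, Fin.sum_univ_succ, Fin.cons_zero, Fin.cons_succ]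

lemma typeCount_update (y : Fin r → ι × κ) (i : Fin r) (w : ι × κ) (j : κ) :
    typeCount (Function.update y i w) j + (if (y i).2 = j then 1 else 0) =
      typeCount y j + if w.2 = j then 1 else 0 := by
  simp only [typeCount]
  rw [← Finset.add_sum_erase _ _ (Finset.mem_univ i),
    ← Finset.add_sum_erase _ (fun a => if (y a).2 = j then 1 else 0) (Finset.mem_univ i),
    Finset.sum_congr (g := fun a => if (y a).2 = j then 1 else 0) rfl]
  · simp only [Function.update_self]; ring
  · intro a ha
    rw [Function.update_of_ne (Finset.ne_of_mem_erase ha)]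

/-- Replacing the vertices of a tuple one at a time by a given vertex: the cocycle property. -/
lemma typeDet_eq_sum_update (k : κ → ℕ) {col : Fin r → ι ⊕ κ} (hcol : Function.Injective col)
    {y : Fin r → ι × κ} {w : ι × κ} (hy : ∀ i, .inr (y i).2 ∈ Set.range col)
    (hw : .inr w.2 ∈ Set.range col) :
    typeDet k col y = ∑ i, typeDet k col (Function.update y i w) := by
  classical
  -- `C j'` is `1` exactly when trading a label over `j'` for `w` turns the type of `y` into `k`. So
  -- `C w.2` tests the type of `y`, and `C (y i).2` that of `y` with its `i`-th entry replaced.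
  set C : κ → ℝ := fun j' => if ∀ j, typeCount y j + (if w.2 = j then 1 else 0) =
    k j + if j' = j then 1 else 0 then 1 else 0 with hC
  have hfun : ∀ u : ι × κ, .inr u.2 ∈ Set.range col →
      ∑ c, vertexVector u (col c) * Sum.elim (fun _ => 0) C (col c) = C u.2 := by
    rintro u ⟨c₀, hc₀⟩
    rw [Fintype.sum_eq_single c₀, hc₀]
    · simp [vertexVector]
    · intro c hc
      rcases hcc : col c with i | j
      · simp
      · have : j ≠ u.2 := fun h => hc (hcol (by rw [hcc, hc₀, h]))
        simp [vertexVector, this]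
  have hsum := coordDet_sum_update col (fun i => vertexVector (y i))
    (fun c => Sum.elim (fun _ => 0) C (col c)) (vertexVector w)
  rw [hfun w hw] at hsum
  have hl : typeDet k col y = C w.2 * coordDet col (fun i => vertexVector (y i)) := by
    simp only [typeDet, hC, add_left_inj, ite_mul, one_mul, zero_mul]
  rw [hl, ← hsum]
  refine Finset.sum_congr rfl fun i _ => ?_
  rw [hfun _ (hy i)]
  have hu : (fun a => vertexVector (Function.update y i w a)) =
      Function.update (fun i => vertexVector (y i)) i (vertexVector w) := by
    funext a
    by_cases h : a = i
    · subst h; simp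
    · simp [h]
  have hiff : (∀ j, typeCount (Function.update y i w) j = k j) ↔
      ∀ j, typeCount y j + (if w.2 = j then 1 else 0) =
        k j + if (y i).2 = j then 1 else 0 := by
    refine forall_congr' fun j => ?_
    rw [← typeCount_update y i w j, add_left_inj]
  simp only [typeDet, hu, hiff, hC, ite_mul, one_mul, zero_mul]

open Classical in
/-- The signed count, over all enumerations of simplices of the face `L`, of those whose labels
have type `k`. -/
noncomputable def total (T : Set (Finset X)) (Φ : X → ι ⊕ κ → ℝ) (g : X → ι × κ)
    (L : Finset (ι ⊕ κ)) (k : κ → ℕ) (col : Fin r → ι ⊕ κ) : ℝ :=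
  ∑ v : Fin r → X, if Admissible T Φ L v then
    orient col (fun i => Φ (v i)) * typeDet k col (fun i => g (v i)) else 0

/-- Each vertex is labelled by a vertex of the smallest face that contains it. -/
def IsLabelling (Φ : X → ι ⊕ κ → ℝ) (g : X → ι × κ) : Prop :=
  ∀ x, 0 < Φ x (.inl (g x).1) ∧ 0 < Φ x (.inr (g x).2)

variable {g : X → ι × κ}

lemma Admissible.comp_perm {v : Fin r → X} (π : Equiv.Perm (Fin r)) :
    Admissible T Φ L (v ∘ π) ↔ Admissible T Φ L v := by
  have h1 : Finset.univ.image (v ∘ π) = Finset.univ.image v := by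
    rw [← Finset.image_image, Finset.image_univ_of_surjective π.surjective]
  have h2 : (∀ i, SupportedIn L (Φ ((v ∘ π) i))) ↔ ∀ i, SupportedIn L (Φ (v i)) :=
    π.forall_congr_right (q := fun i => SupportedIn L (Φ (v i)))
  rw [Admissible, Admissible, h1, h2]

lemma IsLabelling.supportedIn (hg : IsLabelling Φ g) {x : X} (hx : SupportedIn L (Φ x)) :
    SupportedIn L (vertexVector (g x)) := by
  intro l hl
  by_contra h
  rcases (vertexVector_ne_zero_iff _ _).1 h with rfl | rfl
  · exact (hg x).1.ne' (hx _ hl)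
  · exact (hg x).2.ne' (hx _ hl)

lemma IsLabelling.eq_zero (hg : IsLabelling Φ g) {x : X} {l : ι ⊕ κ} (hx : Φ x l = 0) :
    vertexVector (g x) l = 0 := by
  by_contra h
  rcases (vertexVector_ne_zero_iff _ _).1 h with rfl | rfl
  · exact (hg x).1.ne' hx
  · exact (hg x).2.ne' hx

lemma IsChart.inr_mem_range {col : Fin r → ι ⊕ κ} (h : IsChart L i₀ col) {j : κ}
    (hj : .inr j ∈ L) : .inr j ∈ Set.range col :=
  (h.range _).2 ⟨hj, Sum.inr_ne_inl⟩

/-- The cocycle identity replaces each label in turn by `w`. By symmetry the `r + 1` positions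
contribute equally, and in position `0` the replaced vertex matters only through the orientation, so
summing over it gives `linkSum`. -/
lemma total_eq_sum_linkSum (hg : IsLabelling Φ g) {k : κ → ℕ} {col : Fin (r + 1) → ι ⊕ κ}
    (hcol : IsChart L i₀ col) {w : ι × κ} (hw : .inr w.2 ∈ L) :
    total T Φ g L k col = (r + 1) * ∑ v : Fin r → X, linkSum T Φ L col v *
      typeDet k col (Fin.cons w fun i => g (v i)) := by
  classical
  set G : Fin (r + 1) → (Fin (r + 1) → X) → ℝ := fun i v =>
    if Admissible T Φ L v then orient col (fun i => Φ (v i)) *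
      typeDet k col (Function.update (fun i => g (v i)) i w) else 0 with hG
  have h1 : total T Φ g L k col = ∑ i, ∑ v, G i v := by
    rw [Finset.sum_comm, total]
    refine Finset.sum_congr rfl fun v _ => ?_
    simp only [hG]
    split_ifs with hv
    · rw [typeDet_eq_sum_update k hcol.inj (w := w) (fun i => hcol.inr_mem_range ?_)
        (hcol.inr_mem_range hw), Finset.mul_sum]
      by_contra hn
      exact (hg (v i)).2.ne' (hv.2 i _ hn)
    · simp
  have h2 : ∀ i, ∑ v, G i v = ∑ v, G 0 v := by
    intro i
    -- Swapping positions `0` and `i` multiplies the orientation and the label determinant by the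
    -- same sign.
    refine Fintype.sum_equiv (Equiv.arrowCongr (Equiv.swap 0 i) (Equiv.refl X)) _ _ fun v => ?_
    have he : (Equiv.arrowCongr (Equiv.swap 0 i) (Equiv.refl X)) v = v ∘ Equiv.swap 0 i := by
      funext a; simp [Equiv.arrowCongr]
    rw [he]
    simp only [hG, Admissible.comp_perm]
    have e1 : (fun a => Φ ((v ∘ Equiv.swap 0 i) a)) = (fun a => Φ (v a)) ∘ Equiv.swap 0 i := rfl
    have e2 : Function.update (fun a => g ((v ∘ Equiv.swap 0 i) a)) 0 w =
        Function.update (fun a => g (v a)) i w ∘ Equiv.swap 0 i := by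
      funext a
      by_cases ha : a = 0
      · subst ha; simp
      · have : Equiv.swap 0 i a ≠ i := fun h => ha (by
          have := congrArg (Equiv.swap 0 i) h; simpa using this)
        simp [ha, this]
    rw [e1, e2, orient_comp_perm, typeDet_comp_perm]
    have hs : (((Equiv.Perm.sign (Equiv.swap 0 i) : ℤ) : ℝ)) *
        ((Equiv.Perm.sign (Equiv.swap 0 i) : ℤ) : ℝ) = 1 := by
      rcases Int.units_eq_one_or (Equiv.Perm.sign (Equiv.swap 0 i)) with h | h <;> simp [h]
    rw [mul_mul_mul_comm, hs, one_mul]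
  have h3 : ∑ v, G 0 v = ∑ v : Fin r → X, linkSum T Φ L col v *
      typeDet k col (Fin.cons w fun i => g (v i)) := by
    rw [← Equiv.sum_comp (Fin.consEquiv fun _ => X), Fintype.sum_prod_type_right]
    refine Finset.sum_congr rfl fun v _ => ?_
    rw [linkSum, Finset.sum_mul]
    refine Finset.sum_congr rfl fun a _ => ?_
    simp only [hG, Fin.consEquiv, Equiv.coe_fn_mk, comp_cons, Fin.update_cons_zero, ite_mul,
      zero_mul]
  rw [h1, Finset.sum_congr rfl fun i _ => h2 i, h3]
  simp

lemma linkSum_eq_zero_of_not_admissible (hF : IsFan T Φ) {col : Fin (r + 1) → ι ⊕ κ}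
    {v : Fin r → X} (hv : ¬ Admissible T Φ L v) : linkSum T Φ L col v = 0 := by
  refine Finset.sum_eq_zero fun a _ => if_neg fun h => hv ⟨hF.down h.1 ?_, fun i => ?_⟩
  · rw [image_cons]; exact Finset.subset_insert _ _
  · simpa using h.2 i.succ

end Weight

/-! ### Induction over the faces of the product -/

section Induction

variable {ι κ X : Type*} [Fintype ι] [Fintype κ] [DecidableEq ι] [DecidableEq κ]
  [Fintype X] [DecidableEq X] {r : ℕ}
  {T : Set (Finset X)} {Φ : X → ι ⊕ κ → ℝ} {L : Finset (ι ⊕ κ)} {i₀ : ι} {g : X → ι × κ}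

lemma vertexVector_supportedIn {w : ι × κ} (h1 : .inl w.1 ∈ L) (h2 : .inr w.2 ∈ L) :
    SupportedIn L (vertexVector w) := by
  intro l hl
  by_contra h
  rcases (vertexVector_ne_zero_iff _ _).1 h with rfl | rfl <;> contradiction

lemma supportedIn_erase {z : ι ⊕ κ → ℝ} {l : ι ⊕ κ} :
    SupportedIn (L.erase l) z ↔ SupportedIn L z ∧ z l = 0 := by
  refine ⟨fun h => ⟨fun i hi => h i fun h' => hi (Finset.mem_of_mem_erase h'),
    h l (Finset.notMem_erase l L)⟩, fun h i hi => ?_⟩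
  by_cases hil : i = l
  · rw [hil, h.2]
  · exact h.1 i fun h' => hi (Finset.mem_erase.2 ⟨hil, h'⟩)

lemma IsChart.erase {col : Fin (r + 1) → ι ⊕ κ} (h : IsChart L i₀ col) (c : Fin (r + 1)) :
    IsChart (L.erase (col c)) i₀ (col ∘ c.succAbove) where
  mem := Finset.mem_erase.2 ⟨((h.range _).1 ⟨c, rfl⟩).2.symm, h.mem⟩
  inj := h.inj.comp Fin.succAbove_right_injective
  range l := by
    rw [Finset.mem_erase, and_assoc, ← h.range]
    constructor
    · rintro ⟨a, rfl⟩
      exact ⟨fun e => Fin.succAbove_ne c a (h.inj e), c.succAbove a, rfl⟩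
    · rintro ⟨hne, b, rfl⟩
      obtain ⟨a, ha⟩ := Fin.exists_succAbove_eq (x := b) (y := c) fun e => hne (by rw [e])
      exact ⟨a, by rw [← ha]; rfl⟩

/-- The labels of a tuple in a facet not containing `w`, other than the facet `col c`, contribute
nothing after adding `w`. -/
lemma typeDet_cons_eq_zero (hF : IsFan T Φ) (hg : IsLabelling Φ g) {k : κ → ℕ}
    {col : Fin (r + 1) → ι ⊕ κ} (hcol : IsChart L i₀ col) {v : Fin r → X}
    (hv : Admissible T Φ L v) {i : ι} {j : κ} (hi : .inl i ∈ L) (hj : .inr j ∈ L)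
    (c : Fin (r + 1))
    (hc : (col c = .inl i ∧ 2 ≤ k j) ∨ (col c = .inr j ∧ k j = 1 ∧
      (i = i₀ → ∀ i', .inl i' ∈ L → i' = i₀)))
    {l : ι ⊕ κ} (hl : l ∈ L) (hvl : ∀ a, Φ (v a) l = 0) (hvc : ¬ ∀ a, Φ (v a) (col c) = 0) :
    typeDet k col (Fin.cons (i, j) fun a => g (v a)) = 0 := by
  have hb : ∀ a, Balanced (vertexVector
      ((Fin.cons (i, j) fun a => g (v a) : Fin (r + 1) → ι × κ) a)) :=
    fun a => vertexVector_balanced _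
  have hs : ∀ a, SupportedIn L (vertexVector
      ((Fin.cons (i, j) fun a => g (v a) : Fin (r + 1) → ι × κ) a)) := by
    intro a
    refine Fin.cases ?_ (fun a => ?_) a
    · exact vertexVector_supportedIn (w := (i, j)) hi hj
    · exact hg.supportedIn (hv.2 a)
  -- If `w` also lies in the facet `l = 0`, all label vectors do, and the determinant vanishes.
  -- Otherwise `l` is one of the two indices of `w`, and not the one being removed.
  by_cases hw : vertexVector (i, j) l = 0
  · refine typeDet_eq_zero (hcol.coordDet_eq_zero r.succ_pos hl hb hs fun a => ?_)
    refine Fin.cases ?_ (fun a => ?_) a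
    · exact hw
    · exact hg.eq_zero (hvl a)
  have hcount : (∀ a, Φ (v a) (.inr j) = 0) →
      typeCount (Fin.cons (i, j) fun a => g (v a) : Fin (r + 1) → ι × κ) j = 1 := by
    intro h
    rw [typeCount_cons, if_pos rfl, typeCount, Finset.sum_eq_zero, add_zero]
    intro a _
    exact if_neg fun e => (hg (v a)).2.ne' (by rw [e, h a])
  rcases (vertexVector_ne_zero_iff _ _).1 hw with rfl | rfl
  · rcases hc with ⟨hc, -⟩ | ⟨hc, hk, hi₀⟩
    · rw [hc] at hvc; exact absurd hvl hvc
    -- For `i = i₀` there is no column for `.inl i`. But then it is the only coordinate of the first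
    -- factor in `L`, so its vanishing, together with balance, makes every `Φ (v a)` zero,
    -- contradicting `hvc`.
    · by_cases hii : i = i₀
      · refine absurd (fun a => ?_) hvc
        have h1 : ∑ i', Φ (v a) (.inl i') = 0 := by
          refine Finset.sum_eq_zero fun i' _ => ?_
          by_cases h : .inl i' ∈ L
          · rw [hi₀ hii i' h, ← hii]; exact hvl a
          · exact hv.2 a _ h
        rw [hF.balanced (v a)] at h1
        rw [hc]
        exact (Finset.sum_eq_zero_iff_of_nonneg fun j' _ => hF.nonneg (v a) (.inr j')).1 h1 j
          (Finset.mem_univ j)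
      · obtain ⟨c', hc'⟩ := (hcol.range (.inl i)).2 ⟨hl, by simpa using hii⟩
        have hcc : c ≠ c' := fun e => by rw [e, hc'] at hc; exact Sum.inl_ne_inr hc
        rw [typeDet]
        split_ifs with ht
        -- As `k j = 1`, no label but `w` lies over `j`, and none but `w` has first index `i`. The
        -- columns of `.inr j` and `.inl i` therefore coincide.
        · refine coordDet_eq_zero_of_functional (ξ := Pi.single c 1 - Pi.single c' 1)
            (fun h => ?_) fun a => ?_
          · have := congrFun h c
            simp [hcc] at this
          · simp only [Pi.sub_apply, sub_mul, Finset.sum_sub_distrib, Pi.single_apply, ite_mul,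
              one_mul, zero_mul, Finset.sum_ite_eq', Finset.mem_univ, if_true, hc, hc']
            refine Fin.cases ?_ (fun a => ?_) a
            · simp [vertexVector]
            · simp only [Fin.cons_succ]
              rw [hg.eq_zero (hvl a), sub_zero]
              by_contra hne
              have hj' : (g (v a)).2 = j := by
                rcases (vertexVector_ne_zero_iff _ _).1 hne with h | h
                · exact absurd h Sum.inr_ne_inl
                · exact (Sum.inr_injective h).symm
              have h2 := ht j
              rw [typeCount_cons, if_pos rfl, hk, typeCount] at h2
              have h3 : (∑ i, if (g (v i)).2 = j then 1 else 0) = 0 := by omega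
              have := Finset.sum_eq_zero_iff.1 h3 a (Finset.mem_univ a)
              simp [hj'] at this
        · rfl
  · rcases hc with ⟨hc, hk⟩ | ⟨hc, -⟩
    -- On this face no vertex of the tuple can be labelled over `j`, so `w` alone lies there,
    -- whereas `k j ≥ 2`.
    · rw [typeDet, if_neg]
      intro h
      have := h j
      rw [hcount hvl] at this
      omega
    · rw [hc] at hvc; exact absurd hvl hvc

/-- The number of simplices of a face is determined by those of a facet. -/
lemma total_succ (hF : IsFan T Φ) (hg : IsLabelling Φ g) {k : κ → ℕ}
    {col : Fin (r + 1) → ι ⊕ κ} (hcol : IsChart L i₀ col) {i : ι} {j : κ}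
    (hi : .inl i ∈ L) (hj : .inr j ∈ L) (hkj : 1 ≤ k j) (c : Fin (r + 1))
    (hc : (col c = .inl i ∧ 2 ≤ k j) ∨ (col c = .inr j ∧ k j = 1 ∧
      (i = i₀ → ∀ i', .inl i' ∈ L → i' = i₀))) :
    total T Φ g L k col = (r + 1) *
      total T Φ g (L.erase (col c)) (Function.update k j (k j - 1)) (col ∘ c.succAbove) := by
  classical
  rw [total_eq_sum_linkSum hg hcol (w := (i, j)) hj, total]
  congr 1
  refine Finset.sum_congr rfl fun v _ => ?_
  have hwc : vertexVector (i, j) (col c) = 1 := by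
    rcases hc with ⟨h, -⟩ | ⟨h, -⟩ <;> simp [h, vertexVector]
  by_cases hv : Admissible T Φ L v
  swap
  · rw [linkSum_eq_zero_of_not_admissible hF hv, zero_mul, if_neg]
    exact fun h => hv ⟨h.1, fun a => (supportedIn_erase.1 (h.2 a)).1⟩
  by_cases hvc : ∀ a, Φ (v a) (col c) = 0
  · rw [if_pos ⟨hv.1, fun a => supportedIn_erase.2 ⟨hv.2 a, hvc a⟩⟩,
      hF.linkSum_of_mem_facet hcol hv c hvc (w := vertexVector (i, j)) (vertexVector_nonneg _)
        (vertexVector_balanced _) (vertexVector_supportedIn hi hj) (by rw [hwc]; norm_num)]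
    have hiff : (∀ j', typeCount (Fin.cons (i, j) fun a => g (v a) : Fin (r + 1) → ι × κ) j' =
        k j') ↔ ∀ j', typeCount (fun a => g (v a)) j' = Function.update k j (k j - 1) j' := by
      refine forall_congr' fun j' => ?_
      rw [typeCount_cons]
      by_cases h : j' = j
      · subst h; simp; omega
      · simp [h, Ne.symm h]
    simp only [typeDet, hiff]
    rw [orient, orient, comp_cons,
      coordDet_cons_of_eq_zero col _ _ c hvc,
      coordDet_cons_of_eq_zero col _ _ c fun a => hg.eq_zero (hvc a), hwc]
    split_ifs
    -- Expansion along the removed column gives the sign `(-1) ^ c` in the orientation and again in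
    -- the label determinant, so it cancels.
    · rcases neg_one_pow_eq_or ℝ (c : ℕ) with h | h <;> simp [h, Left.sign_neg]
    · simp
  · rw [if_neg fun h => hvc fun a => (supportedIn_erase.1 (h.2 a)).2]
    by_cases hint : ∀ l ∈ L, ∃ a, Φ (v a) l ≠ 0
    · rw [hF.linkSum_of_interior hcol hv hint, zero_mul]
    · push Not at hint
      obtain ⟨l, hl, hvl⟩ := hint
      rw [typeDet_cons_eq_zero hF hg hcol hv hi hj c hc hl hvl hvc, mul_zero]

/-- The signed number of enumerations of simplices of the face `L` with labels of type `k`. -/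
theorem total_eq_factorial (hF : IsFan T Φ) (hg : IsLabelling Φ g) :
    ∀ (r : ℕ) (L : Finset (ι ⊕ κ)) (k : κ → ℕ) (col : Fin r → ι ⊕ κ), IsChart L i₀ col →
      (∀ j, 1 ≤ k j ↔ .inr j ∈ L) → ∑ j, k j = r → total T Φ g L k col = r.factorial
  | 0, L, k, col, hcol, hkL, hk => by
    classical
    have hk0 : ∀ j, k j = 0 := fun j => Finset.sum_eq_zero_iff.1 hk j (Finset.mem_univ j)
    -- The only tuple is the empty one, whose two determinants are empty and equal to `1`.
    rw [total, Fintype.sum_unique, if_pos ⟨by simpa using hF.empty_mem, fun a => a.elim0⟩]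
    simp [orient, typeDet, coordDet, typeCount, hk0]
  | r + 1, L, k, col, hcol, hkL, hk => by
    obtain ⟨j, hj⟩ : ∃ j, 1 ≤ k j := by
      by_contra! h
      rw [Finset.sum_eq_zero fun j _ => Nat.lt_one_iff.1 (h j)] at hk
      omega
    have hjL := (hkL j).1 hj
    obtain ⟨i, c, hi, hc⟩ : ∃ (i : ι) (c : Fin (r + 1)), .inl i ∈ L ∧
        ((col c = .inl i ∧ 2 ≤ k j) ∨ (col c = .inr j ∧ k j = 1 ∧
          (i = i₀ → ∀ i', .inl i' ∈ L → i' = i₀))) := by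
      by_cases h2 : 2 ≤ k j
      · by_cases h : ∃ i, .inl i ∈ L ∧ i ≠ i₀
        · obtain ⟨i, hi, hne⟩ := h
          obtain ⟨c, hc⟩ := (hcol.range (.inl i)).2 ⟨hi, by simpa using hne⟩
          exact ⟨i, c, hi, .inl ⟨hc, h2⟩⟩
        -- If `i₀` were the only first-factor index left, the `r + 1` columns would be distinct
        -- indices `j'` with `k j' ≥ 1`, one of them having `k j ≥ 2`; this exceeds the total `r +
        -- 1`.
        · exfalso
          push Not at h
          have hcr : ∀ c, ∃ j', col c = .inr j' := by
            intro c
            obtain ⟨hcL, hne⟩ := (hcol.range _).1 ⟨c, rfl⟩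
            rcases hcc : col c with i' | j'
            · rw [hcc] at hcL hne
              exact absurd (by rw [h i' hcL]) hne
            · exact ⟨j', rfl⟩
          choose f hf using hcr
          have hfi : Function.Injective f := fun a b e => hcol.inj (by rw [hf, hf, e])
          have h3 : ∑ c, k (f c) ≤ r + 1 := by
            refine le_trans ?_ hk.le
            rw [← Finset.sum_image (s := Finset.univ) (g := f) (f := k)
              (fun a _ b _ hab => hfi hab)]
            exact Finset.sum_le_sum_of_subset (Finset.subset_univ _)
          obtain ⟨c₀, hc₀⟩ := hcol.inr_mem_range hjL
          have h4 : ∑ _c : Fin (r + 1), 1 < ∑ c, k (f c) := by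
            refine Finset.sum_lt_sum (fun c _ => ?_) ⟨c₀, Finset.mem_univ _, ?_⟩
            · rw [hkL, ← hf]; exact ((hcol.range _).1 ⟨c, rfl⟩).1
            · have : f c₀ = j := Sum.inr_injective (by rw [← hf, hc₀])
              rw [this]; omega
          simp at h4
          omega
      · have h1 : k j = 1 := by omega
        obtain ⟨c, hc⟩ := hcol.inr_mem_range hjL
        by_cases h : ∃ i, .inl i ∈ L ∧ i ≠ i₀
        · obtain ⟨i, hi, hne⟩ := h
          exact ⟨i, c, hi, .inr ⟨hc, h1, fun e => absurd e hne⟩⟩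
        · push Not at h
          exact ⟨i₀, c, hcol.mem, .inr ⟨hc, h1, fun _ => h⟩⟩
    rw [total_succ hF hg hcol hi hjL hj c hc,
      total_eq_factorial hF hg r _ _ _ (hcol.erase c) ?_ ?_, Nat.factorial_succ]
    · push_cast; ring
    · intro j'
      rw [Finset.mem_erase]
      by_cases h : j' = j
      · subst h
        rw [Function.update_self]
        rcases hc with ⟨hc, h2⟩ | ⟨hc, h1, -⟩
        · simp [hc, hjL]; omega
        · simp [hc, h1]
      · rw [Function.update_of_ne h, hkL]
        rcases hc with ⟨hc, -⟩ | ⟨hc, -⟩ <;> simp [hc, h]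
    · have h1 := Finset.add_sum_erase Finset.univ k (Finset.mem_univ j)
      have h2 := Finset.add_sum_erase Finset.univ (Function.update k j (k j - 1))
        (Finset.mem_univ j)
      rw [Finset.sum_congr rfl fun j' hj' => Function.update_of_ne (Finset.ne_of_mem_erase hj')
        _ _, Function.update_self] at h2
      omega

end Induction

/-! ### Total unimodularity of the vertex vectors -/

section Unimodular

variable {ι κ : Type*} [Fintype ι] [Fintype κ] [DecidableEq ι] [DecidableEq κ]

/-- The vertices of a product of two simplices are unimodular. -/
lemma coordDet_vertexVector : ∀ (r : ℕ) (col : Fin r → ι ⊕ κ) (_ : Function.Injective col)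
    (y : Fin r → ι × κ), coordDet col (fun i => vertexVector (y i)) = 0 ∨
      coordDet col (fun i => vertexVector (y i)) = 1 ∨
      coordDet col (fun i => vertexVector (y i)) = -1
  | 0, col, _, y => by simp [coordDet]
  | r + 1, col, hcol, y => by
    by_cases h : ∀ i, .inl (y i).1 ∈ Set.range col ∧ .inr (y i).2 ∈ Set.range col
    -- Every row has one `1` in each group of columns, so the alternating sum of the two groups
    -- annihilates the matrix.
    · left
      refine coordDet_eq_zero_of_functional
        (ξ := fun c => Sum.elim (fun _ => (1 : ℝ)) (fun _ => -1) (col c)) (fun h0 => ?_)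
        fun i => ?_
      · have := congrFun h0 0
        rcases hc : col 0 with i | j <;> simp [hc] at this
      · obtain ⟨⟨a, ha⟩, b, hb⟩ := h i
        have hab : a ≠ b := fun e => by rw [e, hb] at ha; exact Sum.inr_ne_inl ha
        rw [Fintype.sum_eq_add a b hab]
        · simp [ha, hb, vertexVector]
        · rintro c ⟨hca, hcb⟩
          have : vertexVector (y i) (col c) = 0 := by
            by_contra hne
            rcases (vertexVector_ne_zero_iff _ _).1 hne with e | e
            · exact hca (hcol (by rw [e, ha]))
            · exact hcb (hcol (by rw [e, hb]))
          rw [this, mul_zero]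
    · push Not at h
      obtain ⟨i, hi⟩ := h
      -- One of the two support indices of row `i` is missing from the columns, so at most one entry
      -- is nonzero; expand along this row.
      obtain ⟨c, hc⟩ : ∃ c, ∀ c' ≠ c, vertexVector (y i) (col c') = 0 := by
        by_cases h1 : ∃ c, vertexVector (y i) (col c) ≠ 0
        · obtain ⟨c, hc⟩ := h1
          refine ⟨c, fun c' hne => ?_⟩
          by_contra hc'
          rcases (vertexVector_ne_zero_iff _ _).1 hc with e | e <;>
            rcases (vertexVector_ne_zero_iff _ _).1 hc' with e' | e'
          · exact hne (hcol (by rw [e, e']))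
          · exact hi ⟨c, e⟩ ⟨c', e'⟩
          · exact hi ⟨c', e'⟩ ⟨c, e⟩
          · exact hne (hcol (by rw [e, e']))
        · push Not at h1
          exact ⟨0, fun c' _ => h1 c'⟩
      have hv : vertexVector (y i) (col c) = 0 ∨ vertexVector (y i) (col c) = 1 := by
        rcases hcc : col c with a | b
        · simp only [vertexVector, Sum.elim_inl, Pi.single_apply]; split_ifs <;> simp
        · simp only [vertexVector, Sum.elim_inr, Pi.single_apply]; split_ifs <;> simp
      have hdet : coordDet col (fun i => vertexVector (y i)) =
          (-1) ^ (i + c : ℕ) * vertexVector (y i) (col c) *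
            coordDet (col ∘ c.succAbove) (fun a => vertexVector (y (i.succAbove a))) := by
        rw [coordDet, Matrix.det_succ_row _ i, Fintype.sum_eq_single c]
        · rfl
        · intro c' hne
          simp [hc c' hne]
      rw [hdet]
      rcases hv with hv | hv
      · simp [hv]
      · rcases neg_one_pow_eq_or ℝ (i + c : ℕ) with h1 | h1 <;>
        rcases coordDet_vertexVector r (col ∘ c.succAbove)
          (hcol.comp Fin.succAbove_right_injective) (fun a => y (i.succAbove a)) with h2 | h2 | h2 <;>
        simp [h1, h2, hv]

end Unimodular

/-! ### Barycentric coordinates as a linear map at height one -/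

section Barycentric

variable {ι E : Type*} [Fintype ι] [DecidableEq ι] [AddCommGroup E] [Module ℝ E]

/-- The linear map `G` extends the barycentric coordinates with respect to the points `p i`,
embedded into `E × ℝ` at height `1`. -/
def IsBarycentricMap (p : ι → E) (G : E × ℝ →ₗ[ℝ] (ι → ℝ)) : Prop :=
  ∀ i, G (p i, 1) = Pi.single i 1

/-- Placed at height `1`, affinely independent points become linearly independent, and a left
inverse of their combination map serves. The points need not span `E`, so the map is only determined
on their span. -/
lemma exists_isBarycentricMap {p : ι → E} (hp : AffineIndependent ℝ p) :
    ∃ G, IsBarycentricMap p G := by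
  have hli : LinearIndependent ℝ fun i => (p i, (1 : ℝ)) := by
    rw [Fintype.linearIndependent_iff]
    intro c hc i
    have h1 := congrArg Prod.fst hc
    have h2 := congrArg Prod.snd hc
    simp only [Prod.fst_sum, Prod.snd_sum, Prod.smul_mk, Prod.fst_zero, Prod.snd_zero, smul_eq_mul,
      mul_one] at h1 h2
    exact affineIndependent_iff.1 hp Finset.univ c h2 h1 i (Finset.mem_univ i)
  obtain ⟨G, hG⟩ := LinearMap.exists_leftInverse_of_injective
    (Fintype.linearCombination ℝ fun i => (p i, (1 : ℝ)))
    (LinearMap.ker_eq_bot.2 hli.fintypeLinearCombination_injective)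
  refine ⟨G, fun i => ?_⟩
  have := LinearMap.congr_fun hG (Pi.single i 1)
  simpa using this

variable {p : ι → E} {G : E × ℝ →ₗ[ℝ] (ι → ℝ)}

lemma IsBarycentricMap.apply_sum (hG : IsBarycentricMap p G) (t : ι → ℝ) :
    G (∑ i, t i • p i, ∑ i, t i) = t := by
  have : (∑ i, t i • p i, ∑ i, t i) = ∑ i, t i • (p i, (1 : ℝ)) := by
    ext <;> simp [Prod.fst_sum, Prod.snd_sum]
  rw [this, map_sum]
  funext j
  simp only [map_smul, hG _, Finset.sum_apply, Pi.smul_apply, Pi.single_apply, smul_eq_mul,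
    mul_ite, mul_one, mul_zero, Finset.sum_ite_eq, Finset.mem_univ, if_true]

lemma IsBarycentricMap.injective (hG : IsBarycentricMap p G) : Function.Injective p := by
  intro i j h
  have := (hG i).symm.trans ((congrArg (fun e => G (e, 1)) h).trans (hG j))
  by_contra hne
  have := congrFun this i
  simp [hne] at this

lemma IsBarycentricMap.of_mem_convexHull (hG : IsBarycentricMap p G) {I : Finset ι} {e : E}
    (he : e ∈ convexHull ℝ (p '' I)) :
    0 ≤ G (e, 1) ∧ (∀ i ∉ I, G (e, 1) i = 0) ∧ ∑ i, G (e, 1) i = 1 ∧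
      ∑ i, G (e, 1) i • p i = e := by
  classical
  rw [← Finset.coe_image, Finset.mem_convexHull'] at he
  obtain ⟨w, hw0, hw1, hwe⟩ := he
  rw [Finset.sum_image fun a _ b _ h => hG.injective h] at hw1 hwe
  set t : ι → ℝ := fun i => if i ∈ I then w (p i) else 0 with ht
  have h1 : ∑ i, t i = 1 := by rw [← hw1]; simp [ht, Finset.sum_ite_mem]
  have h2 : ∑ i, t i • p i = e := by
    rw [← hwe]; simp [ht, ite_smul, Finset.sum_ite_mem]
  have h3 : G (e, 1) = t := by rw [← hG.apply_sum t, h1, h2]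
  rw [h3]
  refine ⟨fun i => ?_, fun i hi => by simp [ht, hi], h1, h2⟩
  simp only [ht, Pi.zero_apply]
  split_ifs with hi
  · exact hw0 _ (Finset.mem_image_of_mem p hi)
  · exact le_rfl

lemma sum_smul_mem_convexHull {I : Finset ι} {t : ι → ℝ} (ht : 0 ≤ t) (hs : ∀ i ∉ I, t i = 0)
    (h1 : ∑ i, t i = 1) : ∑ i, t i • p i ∈ convexHull ℝ (p '' I) := by
  have e1 : ∑ i ∈ I, t i = 1 := by
    rw [← h1]; exact Finset.sum_subset (Finset.subset_univ _) fun i _ hi => hs i hi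
  have e2 : ∑ i ∈ I, t i • p i = ∑ i, t i • p i :=
    Finset.sum_subset (Finset.subset_univ _) fun i _ hi => by rw [hs i hi, zero_smul]
  rw [← e2]
  exact (convex_convexHull ℝ _).sum_mem (fun i _ => ht i) e1
    fun i hi => subset_convexHull ℝ _ ⟨i, hi, rfl⟩

end Barycentric

/-! ### Coordinates on the product and affine independence -/

section ProductCoordinates

variable {E F : Type*} [AddCommGroup E] [Module ℝ E] [AddCommGroup F] [Module ℝ F] {n m : ℕ}

/-- The coordinates on the product of two simplices given by barycentric maps of the factors. -/
def prodCoord (G : E × ℝ →ₗ[ℝ] (Fin (n + 1) → ℝ)) (H : F × ℝ →ₗ[ℝ] (Fin (m + 1) → ℝ))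
    (v : E × F) : Fin (n + 1) ⊕ Fin (m + 1) → ℝ :=
  Sum.elim (G (v.1, 1)) (H (v.2, 1))

/-- The point with given coordinates. -/
def ofCoord (p : Fin (n + 1) → E) (q : Fin (m + 1) → F) :
    (Fin (n + 1) ⊕ Fin (m + 1) → ℝ) →ₗ[ℝ] E × F where
  toFun z := (∑ i, z (.inl i) • p i, ∑ j, z (.inr j) • q j)
  map_add' y z := by simp [add_smul, Finset.sum_add_distrib]
  map_smul' c z := by simp [mul_smul, Finset.smul_sum]

/-- The extreme point of the product with given indices. -/
def vertexPoint (p : Fin (n + 1) → E) (q : Fin (m + 1) → F) (y : Fin (n + 1) × Fin (m + 1)) :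
    E × F :=
  (p y.1, q y.2)

variable {p : Fin (n + 1) → E} {q : Fin (m + 1) → F} {G : E × ℝ →ₗ[ℝ] (Fin (n + 1) → ℝ)}
  {H : F × ℝ →ₗ[ℝ] (Fin (m + 1) → ℝ)}

lemma prodCoord_vertexPoint (hG : IsBarycentricMap p G) (hH : IsBarycentricMap q H)
    (y : Fin (n + 1) × Fin (m + 1)) : prodCoord G H (vertexPoint p q y) = vertexVector y := by
  simp only [prodCoord, vertexPoint, vertexVector, hG _, hH _]

lemma vertexPoint_mem (y : Fin (n + 1) × Fin (m + 1)) :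
    vertexPoint p q y ∈ productPolytope p q :=
  ⟨subset_convexHull ℝ _ ⟨_, rfl⟩, subset_convexHull ℝ _ ⟨_, rfl⟩⟩

lemma prodCoord_of_mem (hG : IsBarycentricMap p G) (hH : IsBarycentricMap q H) {v : E × F}
    (hv : v ∈ productPolytope p q) :
    0 ≤ prodCoord G H v ∧ ∑ i, prodCoord G H v (.inl i) = 1 ∧
      ∑ j, prodCoord G H v (.inr j) = 1 ∧ ofCoord p q (prodCoord G H v) = v := by
  obtain ⟨h1, -, h3, h4⟩ := hG.of_mem_convexHull (I := Finset.univ) (e := v.1)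
    (by simpa using hv.1)
  obtain ⟨k1, -, k3, k4⟩ := hH.of_mem_convexHull (I := Finset.univ) (e := v.2)
    (by simpa using hv.2)
  refine ⟨?_, h3, k3, Prod.ext h4 k4⟩
  rintro (i | j)
  exacts [h1 i, k1 j]

lemma prodCoord_balanced (hG : IsBarycentricMap p G) (hH : IsBarycentricMap q H) {v : E × F}
    (hv : v ∈ productPolytope p q) : Balanced (prodCoord G H v) := by
  obtain ⟨-, h2, h3, -⟩ := prodCoord_of_mem hG hH hv
  rw [Balanced, h2, h3]

/-- Combinations of coordinate vectors. -/
lemma sum_smul_prodCoord {α : Type*} (s : Finset α) (c : α → ℝ) (P : α → E × F) :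
    ∑ a ∈ s, c a • prodCoord G H (P a) =
      Sum.elim (G (∑ a ∈ s, c a • (P a).1, ∑ a ∈ s, c a))
        (H (∑ a ∈ s, c a • (P a).2, ∑ a ∈ s, c a)) := by
  have e1 : (∑ a ∈ s, c a • (P a).1, ∑ a ∈ s, c a) = ∑ a ∈ s, c a • ((P a).1, (1 : ℝ)) := by
    ext <;> simp [Prod.fst_sum, Prod.snd_sum]
  have e2 : (∑ a ∈ s, c a • (P a).2, ∑ a ∈ s, c a) = ∑ a ∈ s, c a • ((P a).2, (1 : ℝ)) := by
    ext <;> simp [Prod.fst_sum, Prod.snd_sum]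
  rw [e1, e2, map_sum, map_sum]
  funext l
  rcases l with i | j <;>
    simp only [prodCoord, map_smul, Finset.sum_apply, Pi.smul_apply, Sum.elim_inl, Sum.elim_inr]

lemma ofCoord_mem {z : Fin (n + 1) ⊕ Fin (m + 1) → ℝ} (hz : 0 ≤ z) (h1 : ∑ i, z (.inl i) = 1)
    (h2 : ∑ j, z (.inr j) = 1) {I : Finset (Fin (n + 1))} {J : Finset (Fin (m + 1))}
    (hI : ∀ i ∉ I, z (.inl i) = 0) (hJ : ∀ j ∉ J, z (.inr j) = 0) :
    ofCoord p q z ∈ convexHull ℝ (p '' I) ×ˢ convexHull ℝ (q '' J) :=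
  ⟨sum_smul_mem_convexHull (p := p) (t := fun i => z (.inl i)) (fun _ => hz _) hI h1,
    sum_smul_mem_convexHull (p := q) (t := fun j => z (.inr j)) (fun _ => hz _) hJ h2⟩

lemma prodCoord_ofCoord (hG : IsBarycentricMap p G) (hH : IsBarycentricMap q H)
    {z : Fin (n + 1) ⊕ Fin (m + 1) → ℝ} (h1 : ∑ i, z (.inl i) = 1) (h2 : ∑ j, z (.inr j) = 1) :
    prodCoord G H (ofCoord p q z) = z := by
  have e1 := hG.apply_sum fun i => z (.inl i)
  have e2 := hH.apply_sum fun j => z (.inr j)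
  rw [h1] at e1
  rw [h2] at e2
  funext l
  rcases l with i | j
  exacts [congrFun e1 i, congrFun e2 j]

lemma affineIndependent_iff_forall_eq_zero {α V : Type*} [Fintype α] [AddCommGroup V] [Module ℝ V]
    {P : α → V} : AffineIndependent ℝ P ↔
      ∀ c : α → ℝ, ∑ i, c i = 0 → ∑ i, c i • P i = 0 → c = 0 := by
  rw [affineIndependent_iff_of_fintype]
  refine forall_congr' fun c => forall_congr' fun hc => ?_
  rw [Finset.weightedVSub_eq_linear_combination _ hc, funext_iff]
  rfl

/-- A combination of points of the product vanishes if and only if that of their coordinate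
vectors does. -/
lemma sum_smul_prodCoord_eq_zero_iff (hG : IsBarycentricMap p G) (hH : IsBarycentricMap q H)
    {α : Type*} [Fintype α] (c : α → ℝ) {P : α → E × F}
    (hP : ∀ a, P a ∈ productPolytope p q) :
    ∑ a, c a • prodCoord G H (P a) = 0 ↔ ∑ a, c a = 0 ∧ ∑ a, c a • P a = 0 := by
  constructor
  · intro h
    have h1 : ∑ i, (∑ a, c a • prodCoord G H (P a)) (.inl i) = ∑ a, c a := by
      simp only [Finset.sum_apply, Pi.smul_apply, smul_eq_mul]
      rw [Finset.sum_comm]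
      refine Finset.sum_congr rfl fun a _ => ?_
      rw [← Finset.mul_sum, (prodCoord_of_mem hG hH (hP a)).2.1, mul_one]
    have h2 : ofCoord p q (∑ a, c a • prodCoord G H (P a)) = ∑ a, c a • P a := by
      rw [map_sum]
      refine Finset.sum_congr rfl fun a _ => ?_
      rw [map_smul, (prodCoord_of_mem hG hH (hP a)).2.2.2]
    rw [h] at h1 h2
    rw [← h1, ← h2]
    simp
  · rintro ⟨h1, h2⟩
    have e1 : ∑ a, c a • (P a).1 = 0 := by simpa [Prod.fst_sum] using congrArg Prod.fst h2
    have e2 : ∑ a, c a • (P a).2 = 0 := by simpa [Prod.snd_sum] using congrArg Prod.snd h2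
    rw [sum_smul_prodCoord, e1, e2, h1, Prod.mk_zero_zero, Prod.mk_zero_zero, map_zero, map_zero]
    funext l
    rcases l with i | j <;> rfl

/-- Affine independence of points of the product is nonvanishing of their determinant. -/
lemma affineIndependent_iff_coordDet_ne_zero (hG : IsBarycentricMap p G)
    (hH : IsBarycentricMap q H) {r : ℕ} {col : Fin r → Fin (n + 1) ⊕ Fin (m + 1)}
    {i₀ : Fin (n + 1)} (hcol : IsChart Finset.univ i₀ col) {P : Fin r → E × F}
    (hP : ∀ i, P i ∈ productPolytope p q) :
    AffineIndependent ℝ P ↔ coordDet col (fun i => prodCoord G H (P i)) ≠ 0 := by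
  rw [affineIndependent_iff_forall_eq_zero, coordDet, Ne, ← Matrix.exists_vecMul_eq_zero_iff]
  push Not
  refine forall_congr' fun c => ?_
  have hiff : Matrix.vecMul c (Matrix.of fun i k => prodCoord G H (P i) (col k)) = 0 ↔
      ∑ a, c a = 0 ∧ ∑ a, c a • P a = 0 := by
    rw [← sum_smul_prodCoord_eq_zero_iff hG hH c hP]
    constructor
    · intro h
      refine hcol.eq_zero (Balanced.sum _ fun a => (prodCoord_balanced hG hH (hP a)).smul _)
        (fun l hl => absurd (Finset.mem_univ l) hl) fun k => ?_
      have := congrFun h k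
      simpa [Matrix.vecMul, dotProduct, Finset.sum_apply] using this
    · intro h
      funext k
      have := congrFun h (col k)
      simpa [Matrix.vecMul, dotProduct, Finset.sum_apply] using this
  simp only [ne_eq, hiff]
  tauto

end ProductCoordinates

/-! ### From triangulations and Sperner labellings to fans and labellings -/

section Triangulation

variable {E F : Type*} [AddCommGroup E] [Module ℝ E] [AddCommGroup F] [Module ℝ F] {n m : ℕ}
  {p : Fin (n + 1) → E} {q : Fin (m + 1) → F} {G : E × ℝ →ₗ[ℝ] (Fin (n + 1) → ℝ)}
  {H : F × ℝ →ₗ[ℝ] (Fin (m + 1) → ℝ)}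

/-- The simplices of a complex and the empty set, as sets of vertices. -/
def vertexFan {V : Type*} [AddCommGroup V] [Module ℝ V] (T : Geometry.SimplicialComplex ℝ V) :
    Set (Finset T.vertices) :=
  {s | s = ∅ ∨ s.map (Function.Embedding.subtype _) ∈ T.faces}

section Weights

variable {V : Type*} [AddCommGroup V] [Module ℝ V] {T : Geometry.SimplicialComplex ℝ V}

lemma finite_vertices (h : T.faces.Finite) : T.vertices.Finite := by
  rw [Geometry.SimplicialComplex.vertices_eq]
  exact h.biUnion fun s _ => s.finite_toSet

lemma exists_map_subtype_eq {σ : Finset V} (hσ : σ ∈ T.faces) :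
    ∃ s : Finset T.vertices, s.map (Function.Embedding.subtype _) = σ := by
  classical
  refine ⟨σ.subtype _, ?_⟩
  rw [Finset.subtype_map, Finset.filter_eq_self]
  intro x hx
  exact T.down_closed hσ (Finset.singleton_subset_iff.2 hx) (Finset.singleton_nonempty x)

variable [Fintype T.vertices]

lemma exists_weights_of_mem_convexHull {s : Finset T.vertices} {e : V}
    (he : e ∈ convexHull ℝ (s.map (Function.Embedding.subtype _) : Set V)) :
    ∃ u : T.vertices → ℝ, 0 ≤ u ∧ (∀ x ∉ s, u x = 0) ∧ ∑ x, u x = 1 ∧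
      ∑ x, u x • (x : V) = e := by
  classical
  obtain ⟨w, hw0, hw1, hwe⟩ := Finset.mem_convexHull'.1 he
  rw [Finset.sum_map] at hw1 hwe
  refine ⟨fun x => if x ∈ s then w x else 0, fun x => ?_, fun x hx => by simp [hx], ?_, ?_⟩
  · simp only [Pi.zero_apply]
    split_ifs with hx
    · exact hw0 _ (Finset.mem_map_of_mem _ hx)
    · exact le_rfl
  · rw [← hw1]; simp [Finset.sum_ite_mem]
  · rw [← hwe]; simp [ite_smul, Finset.sum_ite_mem]

lemma mem_convexHull_of_weights {s : Finset T.vertices} {u : T.vertices → ℝ} (h0 : 0 ≤ u)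
    (hs : ∀ x ∉ s, u x = 0) (h1 : ∑ x, u x = 1) :
    ∑ x, u x • (x : V) ∈ convexHull ℝ (s.map (Function.Embedding.subtype _) : Set V) := by
  have e1 : ∑ x ∈ s, u x = 1 := by
    rw [← h1]; exact Finset.sum_subset (Finset.subset_univ _) fun i _ hi => hs i hi
  have e2 : ∑ x ∈ s, u x • (x : V) = ∑ x, u x • (x : V) :=
    Finset.sum_subset (Finset.subset_univ _) fun i _ hi => by rw [hs i hi, zero_smul]
  rw [← e2]
  exact (convex_convexHull ℝ _).sum_mem (fun i _ => h0 i) e1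
    fun i hi => subset_convexHull ℝ _ (Finset.mem_coe.2 (Finset.mem_map_of_mem _ hi))

/-- Barycentric coordinates in a simplex are unique. -/
lemma weights_unique {s : Finset T.vertices} (hs : s ∈ vertexFan T) {u w : T.vertices → ℝ}
    (hu : ∀ x ∉ s, u x = 0) (hw : ∀ x ∉ s, w x = 0) (h1 : ∑ x, u x = ∑ x, w x)
    (h2 : ∑ x, u x • (x : V) = ∑ x, w x • (x : V)) : u = w := by
  classical
  rcases hs with rfl | hs
  · funext x; rw [hu x (by simp), hw x (by simp)]
  have hind := T.indep hs
  set d : V → ℝ := fun v => if h : v ∈ T.vertices then u ⟨v, h⟩ - w ⟨v, h⟩ else 0 with hd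
  have hdx : ∀ x : T.vertices, d x = u x - w x := fun x => by simp [hd]
  have e1 : ∑ v ∈ s.map (Function.Embedding.subtype _), d v = 0 := by
    rw [Finset.sum_map, Finset.sum_subset (Finset.subset_univ s) fun x _ hx => ?_]
    · simp only [Function.Embedding.subtype_apply, hdx, Finset.sum_sub_distrib, h1, sub_self]
    · simp only [Function.Embedding.subtype_apply, hdx, hu x hx, hw x hx, sub_self]
  have e2 : ∑ v ∈ s.map (Function.Embedding.subtype _), d v • v = 0 := by
    rw [Finset.sum_map, Finset.sum_subset (Finset.subset_univ s) fun x _ hx => ?_]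
    · simp only [Function.Embedding.subtype_apply, hdx, sub_smul, Finset.sum_sub_distrib, h2,
        sub_self]
    · simp only [Function.Embedding.subtype_apply, hdx, hu x hx, hw x hx, sub_self, zero_smul]
  have := hind.eq_zero_of_sum_eq_zero_subtype e1 e2
  funext x
  by_cases hx : x ∈ s
  · have h3 := this x (Finset.mem_map_of_mem _ hx)
    rw [hdx] at h3; linarith
  · rw [hu x hx, hw x hx]

lemma empty_mem_vertexFan : ∅ ∈ vertexFan T := .inl rfl

lemma vertexFan_down {s t : Finset T.vertices} (hs : s ∈ vertexFan T) (hts : t ⊆ s) :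
    t ∈ vertexFan T := by
  rcases t.eq_empty_or_nonempty with h | h
  · exact .inl h
  rcases hs with rfl | hs
  · exact .inl (Finset.subset_empty.1 hts)
  · exact .inr (T.down_closed hs (Finset.map_subset_map.2 hts) (h.map))

/-- A nonnegative combination of the vertices, at a given height, over two simplices. -/
lemma weights_unique_of_mem {s t : Finset T.vertices} (hs : s ∈ vertexFan T)
    (ht : t ∈ vertexFan T) {u w : T.vertices → ℝ} (hu0 : 0 ≤ u) (hw0 : 0 ≤ w)
    (hu : ∀ x ∉ s, u x = 0) (hw : ∀ x ∉ t, w x = 0) (h1 : ∑ x, u x = ∑ x, w x)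
    (h2 : ∑ x, u x • (x : V) = ∑ x, w x • (x : V)) : u = w := by
  classical
  -- Common height of the two combinations: height zero forces both weights to vanish, and otherwise
  -- dividing by `c` gives convex combinations.
  set c := ∑ x, u x with hc
  have hc0 : 0 ≤ c := Finset.sum_nonneg fun x _ => hu0 x
  rcases hc0.eq_or_lt with h0 | hcpos
  · have hu' := (Finset.sum_eq_zero_iff_of_nonneg fun x _ => hu0 x).1 h0.symm
    have hw' := (Finset.sum_eq_zero_iff_of_nonneg fun x _ => hw0 x).1 (h1.symm.trans h0.symm)
    funext x
    rw [hu' x (Finset.mem_univ x), hw' x (Finset.mem_univ x)]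
  have hne : c ≠ 0 := hcpos.ne'
  rcases hs with rfl | hs
  · exact absurd (Finset.sum_eq_zero fun x _ => hu x (by simp)) hne
  rcases ht with rfl | ht
  · exact absurd (h1.trans (Finset.sum_eq_zero fun x _ => hw x (by simp))) hne
  have hscale : ∀ a : T.vertices → ℝ, ∑ x, (c⁻¹ • a) x • (x : V) = c⁻¹ • ∑ x, a x • (x : V) := by
    intro a
    rw [Finset.smul_sum]
    exact Finset.sum_congr rfl fun x _ => by rw [Pi.smul_apply, smul_eq_mul, mul_smul]
  have hsum : ∀ a : T.vertices → ℝ, ∑ x, (c⁻¹ • a) x = c⁻¹ * ∑ x, a x := by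
    intro a
    rw [Finset.mul_sum]; rfl
  have hcinv : 0 ≤ c⁻¹ := inv_nonneg.2 hc0
  have hus : ∀ x ∉ s, (c⁻¹ • u) x = 0 := fun x hx => by simp [hu x hx]
  have hwt : ∀ x ∉ t, (c⁻¹ • w) x = 0 := fun x hx => by simp [hw x hx]
  have hu1 : ∑ x, (c⁻¹ • u) x = 1 := by rw [hsum, inv_mul_cancel₀ hne]
  have hw1 : ∑ x, (c⁻¹ • w) x = 1 := by rw [hsum, ← h1, inv_mul_cancel₀ hne]
  have hmu := mem_convexHull_of_weights (smul_nonneg hcinv hu0) hus hu1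
  have hmw := mem_convexHull_of_weights (smul_nonneg hcinv hw0) hwt hw1
  have heq : ∑ x, (c⁻¹ • u) x • (x : V) = ∑ x, (c⁻¹ • w) x • (x : V) := by
    rw [hscale, hscale, h2]
  rw [← heq] at hmw
  -- The common point lies in the hull of the common vertices; its weights there agree with both
  -- given ones, by uniqueness inside each simplex.
  have hmem := T.inter_subset_convexHull hs ht ⟨hmu, hmw⟩
  rw [← Finset.coe_inter, ← Finset.map_inter] at hmem
  obtain ⟨b, -, hb, hb1, hbe⟩ := exists_weights_of_mem_convexHull hmem
  have k1 : c⁻¹ • u = b := weights_unique (.inr hs) hus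
    (fun x hx => hb x fun h => hx (Finset.mem_inter.1 h).1) (hu1.trans hb1.symm) hbe.symm
  have k2 : c⁻¹ • w = b := weights_unique (.inr ht) hwt
    (fun x hx => hb x fun h => hx (Finset.mem_inter.1 h).2) (hw1.trans hb1.symm)
    (heq.symm.trans hbe.symm)
  exact smul_right_injective _ (inv_ne_zero hne) (k1.trans k2.symm)

end Weights

variable {T : Geometry.SimplicialComplex ℝ (E × F)}

lemma IsTriangulation.vertex_mem (hT : IsTriangulation T (productPolytope p q))
    (x : T.vertices) : (x : E × F) ∈ productPolytope p q := by
  rw [← hT.space_eq]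
  exact T.vertices_subset_space x.2

variable [Fintype T.vertices]

/-- A triangulation of the product of two simplices gives a fan. -/
lemma IsTriangulation.isFan (hT : IsTriangulation T (productPolytope p q))
    (hG : IsBarycentricMap p G) (hH : IsBarycentricMap q H) :
    IsFan (vertexFan T) fun x : T.vertices => prodCoord G H x where
  empty_mem := empty_mem_vertexFan
  down _ _ hs hts := vertexFan_down hs hts
  nonneg x := (prodCoord_of_mem hG hH (hT.vertex_mem x)).1
  balanced x := prodCoord_balanced hG hH (hT.vertex_mem x)
  unique s t hs ht u w hu0 hw0 hu hw h := by
    have h0 : ∑ x, (u x - w x) • prodCoord G H x = 0 := by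
      simp only [sub_smul, Finset.sum_sub_distrib, h, sub_self]
    obtain ⟨h1, h2⟩ := (sum_smul_prodCoord_eq_zero_iff hG hH (fun x => u x - w x)
      (P := fun x : T.vertices => (x : E × F)) hT.vertex_mem).1 h0
    simp only [sub_smul, Finset.sum_sub_distrib, sub_eq_zero] at h1 h2
    exact weights_unique_of_mem hs ht hu0 hw0 hu hw h1 h2
  cover z hz hb := by
    set c := ∑ i, z (.inl i) with hc
    have hc0 : 0 ≤ c := Finset.sum_nonneg fun i _ => hz _
    have hcj : ∑ j, z (.inr j) = c := hb.symm
    rcases hc0.eq_or_lt with h0 | hcpos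
    -- Height zero is the apex of the cone, carried by the empty simplex; this is why `vertexFan`
    -- includes it.
    · refine ⟨∅, empty_mem_vertexFan, 0, le_rfl, fun _ _ => rfl, ?_⟩
      have h1 := (Finset.sum_eq_zero_iff_of_nonneg fun i _ => hz (.inl i)).1 h0.symm
      have h2 := (Finset.sum_eq_zero_iff_of_nonneg fun j _ => hz (.inr j)).1 (hcj.trans h0.symm)
      funext l
      rcases l with i | j
      · simpa using h1 i (Finset.mem_univ i)
      · simpa using h2 j (Finset.mem_univ j)
    have hne : c ≠ 0 := hcpos.ne'
    have e1 : ∑ i, (c⁻¹ • z) (.inl i) = 1 := by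
      simp only [Pi.smul_apply, smul_eq_mul, ← Finset.mul_sum]
      exact inv_mul_cancel₀ hne
    have e2 : ∑ j, (c⁻¹ • z) (.inr j) = 1 := by
      simp only [Pi.smul_apply, smul_eq_mul, ← Finset.mul_sum, hcj]
      exact inv_mul_cancel₀ hne
    have hmem : ofCoord p q (c⁻¹ • z) ∈ productPolytope p q := by
      have := ofCoord_mem (p := p) (q := q) (smul_nonneg (inv_nonneg.2 hc0) hz) e1 e2
        (I := Finset.univ) (J := Finset.univ) (by simp) (by simp)
      simpa [productPolytope] using this
    rw [← hT.space_eq, Geometry.SimplicialComplex.mem_space_iff] at hmem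
    obtain ⟨σ, hσ, hmem⟩ := hmem
    obtain ⟨s, rfl⟩ := exists_map_subtype_eq hσ
    obtain ⟨u, hu0, hus, hu1, hue⟩ := exists_weights_of_mem_convexHull hmem
    refine ⟨s, .inr hσ, c • u, smul_nonneg hc0 hu0, fun x hx => by simp [hus x hx], ?_⟩
    have h1 : ∑ x, u x • prodCoord G H (x : E × F) = prodCoord G H (ofCoord p q (c⁻¹ • z)) := by
      rw [sum_smul_prodCoord, hu1, ← hue]
      simp only [prodCoord, Prod.fst_sum, Prod.snd_sum, Prod.smul_fst, Prod.smul_snd]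
    rw [prodCoord_ofCoord hG hH e1 e2] at h1
    have h2 : ∑ x, (c • u) x • prodCoord G H (x : E × F) =
        c • ∑ x, u x • prodCoord G H (x : E × F) := by
      rw [Finset.smul_sum]
      exact Finset.sum_congr rfl fun x _ => by rw [Pi.smul_apply, smul_eq_mul, mul_smul]
    rw [h2, h1, smul_smul, mul_inv_cancel₀ hne, one_smul]

/-- A generalized Sperner labelling assigns to each vertex an extreme point of the smallest cell
that contains the vertex. -/
lemma IsGeneralizedSperner.exists_labelling {C : Type*} {f : E × F → C}
    (hT : IsTriangulation T (productPolytope p q))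
    (hf : IsGeneralizedSperner (productCells p q) (productVertices p q) T f)
    (hG : IsBarycentricMap p G) (hH : IsBarycentricMap q H) :
    ∃ g : T.vertices → Fin (n + 1) × Fin (m + 1),
      IsLabelling (fun x : T.vertices => prodCoord G H x) g ∧
      ∀ x : T.vertices, f x = f (vertexPoint p q (g x)) := by
  classical
  have key : ∀ x : T.vertices, ∃ y : Fin (n + 1) × Fin (m + 1),
      (0 < prodCoord G H (x : E × F) (.inl y.1) ∧ 0 < prodCoord G H (x : E × F) (.inr y.2)) ∧
      f x = f (vertexPoint p q y) := by
    intro x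
    obtain ⟨h0, h1, h2, h3⟩ := prodCoord_of_mem hG hH (hT.vertex_mem x)
    set z := prodCoord G H (x : E × F) with hz
    -- The supports of the two coordinate vectors describe the smallest cell containing `x`.
    set I : Finset (Fin (n + 1)) := {i | z (.inl i) ≠ 0} with hI
    set J : Finset (Fin (m + 1)) := {j | z (.inr j) ≠ 0} with hJ
    have hI' : ∀ i ∉ I, z (.inl i) = 0 := fun i hi => by simpa [hI] using hi
    have hJ' : ∀ j ∉ J, z (.inr j) = 0 := fun j hj => by simpa [hJ] using hj
    have hIn : I.Nonempty := by
      by_contra hn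
      rw [Finset.not_nonempty_iff_eq_empty] at hn
      rw [Finset.sum_eq_zero fun i _ => hI' i (by simp [hn])] at h1
      exact zero_ne_one h1
    have hJn : J.Nonempty := by
      by_contra hn
      rw [Finset.not_nonempty_iff_eq_empty] at hn
      rw [Finset.sum_eq_zero fun j _ => hJ' j (by simp [hn])] at h2
      exact zero_ne_one h2
    have hxc := ofCoord_mem (p := p) (q := q) h0 h1 h2 hI' hJ'
    rw [h3] at hxc
    obtain ⟨w, ⟨⟨a, ha⟩, ⟨b, hb⟩⟩, hw, hfw⟩ := hf x x.2 _ ⟨I, J, hIn, hJn, rfl⟩ hxc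
    have hwab : w = vertexPoint p q (a, b) := Prod.ext ha.symm hb.symm
    -- Coordinates outside `I` and `J` vanish on the cell and, being affine, on its affine span. An
    -- extreme point there must have its indices in `I` and `J`.
    have hzero : (∀ i ∉ I, G (w.1, 1) i = 0) ∧ (∀ j ∉ J, H (w.2, 1) j = 0) := by
      refine affineSpan_induction
        (p := fun w : E × F => (∀ i ∉ I, G (w.1, 1) i = 0) ∧ (∀ j ∉ J, H (w.2, 1) j = 0)) hw ?_ ?_
      · rintro v ⟨hv1, hv2⟩
        exact ⟨(hG.of_mem_convexHull hv1).2.1, (hH.of_mem_convexHull hv2).2.1⟩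
      · intro c u v w hu hv hw
        have e1 : ((c • (u -ᵥ v) +ᵥ w).1, (1 : ℝ)) =
            c • ((u.1, (1 : ℝ)) - (v.1, 1)) + (w.1, 1) := by
          ext <;> simp
        have e2 : ((c • (u -ᵥ v) +ᵥ w).2, (1 : ℝ)) =
            c • ((u.2, (1 : ℝ)) - (v.2, 1)) + (w.2, 1) := by
          ext <;> simp
        rw [e1, e2]
        simp only [map_add, map_smul, map_sub, Pi.add_apply, Pi.smul_apply, Pi.sub_apply]
        exact ⟨fun i hi => by simp [hu.1 i hi, hv.1 i hi, hw.1 i hi],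
          fun j hj => by simp [hu.2 j hj, hv.2 j hj, hw.2 j hj]⟩
    refine ⟨(a, b), ⟨lt_of_le_of_ne (h0 _) fun h => ?_, lt_of_le_of_ne (h0 _) fun h => ?_⟩,
      hwab ▸ hfw⟩
    · have := hzero.1 a (by simpa [hI] using h.symm)
      rw [← ha, hG a] at this
      simp at this
    · have := hzero.2 b (by simpa [hJ] using h.symm)
      rw [← hb, hH b] at this
      simp at this
  choose g hg using key
  exact ⟨g, fun x => (hg x).1, fun x => (hg x).2⟩

end Triangulation

/-! ### Passing from enumerations to unordered simplices -/

section Enumeration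

variable {X : Type*} [Fintype X] [DecidableEq X] {r : ℕ}

lemma exists_perm_of_image_eq {v w : Fin r → X} (hv : Function.Injective v)
    (h : Finset.univ.image v = Finset.univ.image w) :
    ∃ π : Equiv.Perm (Fin r), v = w ∘ π := by
  have : ∀ i, ∃ j, w j = v i := fun i => by
    have : v i ∈ Finset.univ.image w := h ▸ Finset.mem_image_of_mem v (Finset.mem_univ i)
    simpa using this
  choose π hπ using this
  have hπi : Function.Injective π := fun i j hij => hv (by rw [← hπ i, ← hπ j, hij])
  exact ⟨Equiv.ofBijective π (Finite.injective_iff_bijective.1 hπi), funext fun i => (hπ i).symm⟩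

/-- A sum over tuples as a sum over finite sets. -/
lemma exists_sum_tuples_eq (f : (Fin r → X) → ℝ)
    (hperm : ∀ v (π : Equiv.Perm (Fin r)), f (v ∘ π) = f v)
    (hinj : ∀ v, ¬ Function.Injective v → f v = 0) :
    ∃ val : Finset X → ℝ, (∀ v, Function.Injective v → val (Finset.univ.image v) = f v) ∧
      (∀ s, val s ≠ 0 → ∃ v : Fin r → X, Function.Injective v ∧ Finset.univ.image v = s) ∧
      ∑ v, f v = r.factorial * ∑ s : Finset X, val s := by
  classical
  have hchoice : ∀ s : Finset X, s.card = r → ∃ v : Fin r → X,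
      Function.Injective v ∧ Finset.univ.image v = s := by
    intro s h
    refine ⟨fun i => (s.equivFinOfCardEq h).symm i, fun i j hij => ?_, ?_⟩
    · exact (s.equivFinOfCardEq h).symm.injective (Subtype.ext hij)
    · ext x
      simp only [Finset.mem_image, Finset.mem_univ, true_and]
      constructor
      · rintro ⟨i, rfl⟩; exact Subtype.prop _
      · intro hx; exact ⟨s.equivFinOfCardEq h ⟨x, hx⟩, by simp⟩
  have hcard : ∀ v : Fin r → X, Function.Injective v → (Finset.univ.image v).card = r := by
    intro v hv
    rw [Finset.card_image_of_injective _ hv, Finset.card_univ, Fintype.card_fin]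
  set val : Finset X → ℝ := fun s => if h : s.card = r then f (hchoice s h).choose else 0
    with hval
  have h1 : ∀ v, Function.Injective v → val (Finset.univ.image v) = f v := by
    intro v hv
    obtain ⟨hi, him⟩ := (hchoice _ (hcard v hv)).choose_spec
    obtain ⟨π, hπ⟩ := exists_perm_of_image_eq hv him.symm
    simp only [hval, dif_pos (hcard v hv)]
    rw [← hperm _ π, ← hπ]
  have h2 : ∀ s, val s ≠ 0 → ∃ v : Fin r → X, Function.Injective v ∧ Finset.univ.image v = s := by
    intro s hs
    by_cases h : s.card = r
    · exact hchoice s h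
    · exact absurd (dif_neg h) hs
  refine ⟨val, h1, h2, ?_⟩
  rw [← Finset.sum_fiberwise Finset.univ (fun v : Fin r → X => Finset.univ.image v) f,
    Finset.mul_sum]
  refine Finset.sum_congr rfl fun s _ => ?_
  by_cases hs : ∃ v : Fin r → X, Function.Injective v ∧ Finset.univ.image v = s
  · obtain ⟨w, hw, rfl⟩ := hs
    -- The enumerations of a given vertex set form one free orbit of the symmetric group, which
    -- accounts for the factor `r!`.
    have hset : ({v | Finset.univ.image v = Finset.univ.image w} : Finset (Fin r → X)) =
        Finset.univ.image fun π : Equiv.Perm (Fin r) => w ∘ π := by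
      ext v
      simp only [Finset.mem_filter, Finset.mem_univ, true_and, Finset.mem_image]
      constructor
      · intro h
        have hv : Function.Injective v := by
          rw [← Set.injOn_univ, ← Finset.coe_univ, ← Finset.card_image_iff, h, hcard w hw,
            Finset.card_univ, Fintype.card_fin]
        obtain ⟨π, hπ⟩ := exists_perm_of_image_eq hv h
        exact ⟨π, hπ.symm⟩
      · rintro ⟨π, rfl⟩
        rw [← Finset.image_image, Finset.image_univ_of_surjective π.surjective]
    have hcomp : Function.Injective fun π : Equiv.Perm (Fin r) => w ∘ π :=
      fun π π' h => Equiv.ext fun i => hw (congrFun h i)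
    rw [hset, Finset.sum_image hcomp.injOn, h1 w hw,
      Finset.sum_congr rfl fun π _ => hperm w π, Finset.sum_const, Finset.card_univ,
      Fintype.card_perm, Fintype.card_fin, nsmul_eq_mul]
  · rw [not_not.1 fun h => hs (h2 s h), mul_zero]
    refine Finset.sum_eq_zero fun v hv => hinj v fun hvi => hs ⟨v, hvi, ?_⟩
    exact (Finset.mem_filter.1 hv).2

end Enumeration

/-! ### Types, barycentric matrices and determinants -/

section Count

variable {E F : Type*} [AddCommGroup E] [Module ℝ E] [AddCommGroup F] [Module ℝ F] {n m : ℕ}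
  {p : Fin (n + 1) → E} {q : Fin (m + 1) → F} {G : E × ℝ →ₗ[ℝ] (Fin (n + 1) → ℝ)}
  {H : F × ℝ →ₗ[ℝ] (Fin (m + 1) → ℝ)} {k : Fin (m + 1) → ℕ}

lemma exists_isChart (n m : ℕ) : ∃ col : Fin (n + m + 1) → Fin (n + 1) ⊕ Fin (m + 1),
    IsChart Finset.univ 0 col := by
  have hcard : (Finset.univ.erase (.inl 0 : Fin (n + 1) ⊕ Fin (m + 1))).card = n + m + 1 := by
    rw [Finset.card_erase_of_mem (Finset.mem_univ _), Finset.card_univ, Fintype.card_sum,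
      Fintype.card_fin, Fintype.card_fin]
    omega
  set e := Finset.equivFinOfCardEq hcard
  refine ⟨fun i => e.symm i, Finset.mem_univ _, fun i j h => e.symm.injective (Subtype.ext h),
    fun l => ⟨?_, fun h => ?_⟩⟩
  · rintro ⟨c, rfl⟩
    exact ⟨Finset.mem_univ _, (Finset.mem_erase.1 (e.symm c).2).1⟩
  · exact ⟨e ⟨l, Finset.mem_erase.2 ⟨h.2, h.1⟩⟩, by simp⟩

lemma ncard_eq_typeCount (hq : Function.Injective q) {r : ℕ} {y : Fin r → Fin (n + 1) × Fin (m + 1)}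
    {τ : Finset (E × F)} (hy : Function.Injective fun i => vertexPoint p q (y i))
    (hτ : ∀ w, w ∈ τ ↔ ∃ i, vertexPoint p q (y i) = w) (j : Fin (m + 1)) :
    {w | w ∈ τ ∧ w.2 = q j}.ncard = typeCount y j := by
  have : {w | w ∈ τ ∧ w.2 = q j} = (fun i => vertexPoint p q (y i)) '' {i | (y i).2 = j} := by
    ext w
    simp only [Set.mem_ofPred_eq, hτ, Set.mem_image]
    constructor
    · rintro ⟨⟨i, rfl⟩, h⟩
      exact ⟨i, hq h, rfl⟩
    · rintro ⟨i, rfl, rfl⟩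
      exact ⟨⟨i, rfl⟩, rfl⟩
  rw [this, Set.ncard_image_of_injective _ hy, typeCount, Finset.sum_boole, Nat.cast_id,
    Set.ncard_eq_toFinset_card']
  congr 1
  ext i
  simp

variable {r : ℕ} {col : Fin r → Fin (n + 1) ⊕ Fin (m + 1)} {i₀ : Fin (n + 1)}

/-- Barycentric matrices relate the determinants of two simplices. -/
lemma IsBarycentricMatrix.coordDet_eq {α : Type*} [Fintype α] [DecidableEq α]
    {s t : α → E × F} {A : Matrix α α ℝ} (hA : IsBarycentricMatrix s t A) (a : Fin r ≃ α) :
    coordDet col (fun i => prodCoord G H (s (a i))) =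
      A.det * coordDet col (fun i => prodCoord G H (t (a i))) := by
  rw [← Matrix.det_submatrix_equiv_self a A, coordDet, coordDet, ← Matrix.det_mul]
  congr 1
  ext i c
  obtain ⟨h1, h2⟩ := hA (a i)
  have h3 := sum_smul_prodCoord (G := G) (H := H) Finset.univ (A (a i)) t
  rw [h1] at h3
  have h4 : prodCoord G H (s (a i)) = ∑ b, A (a i) b • prodCoord G H (t b) := by
    rw [h3, h2]
    simp only [prodCoord, Prod.fst_sum, Prod.snd_sum, Prod.smul_fst, Prod.smul_snd]
  rw [Matrix.mul_apply, Matrix.of_apply, h4, Finset.sum_apply, ← Equiv.sum_comp a]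
  rfl

/-- The matrix solves the problem on the chart columns by inverting that of `t`. Injectivity of the
chart extends the identity to all coordinates, and hence to the points themselves. -/
lemma exists_isBarycentricMatrix (hG : IsBarycentricMap p G) (hH : IsBarycentricMap q H)
    (hcol : IsChart Finset.univ i₀ col) {α : Type*} [Fintype α]
    {s t : α → E × F} (a : Fin r ≃ α) (hs : ∀ i, s i ∈ productPolytope p q)
    (ht : ∀ i, t i ∈ productPolytope p q)
    (hdet : coordDet col (fun i => prodCoord G H (t (a i))) ≠ 0) :
    ∃ A : Matrix α α ℝ, IsBarycentricMatrix s t A := by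
  classical
  set N : Matrix (Fin r) (Fin r) ℝ := Matrix.of fun i c => prodCoord G H (t (a i)) (col c) with hN
  set M : Matrix (Fin r) (Fin r) ℝ := Matrix.of fun i c => prodCoord G H (s (a i)) (col c) with hM
  set B := M * N⁻¹ with hB
  have hBN : B * N = M := by
    rw [hB, Matrix.mul_assoc, Matrix.nonsing_inv_mul _ (isUnit_iff_ne_zero.2 hdet), Matrix.mul_one]
  have key : ∀ i, prodCoord G H (s (a i)) + (-1 : ℝ) • ∑ j, B i j • prodCoord G H (t (a j)) = 0 := by
    intro i
    refine hcol.eq_zero ?_ (fun l hl => absurd (Finset.mem_univ l) hl) fun c => ?_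
    · exact (prodCoord_balanced hG hH (hs _)).add
        ((Balanced.sum _ fun j => (prodCoord_balanced hG hH (ht _)).smul _).smul _)
    · have := congrFun (congrFun hBN i) c
      rw [Matrix.mul_apply] at this
      simp only [hN, hM, Matrix.of_apply] at this
      simp [Finset.sum_apply, this]
  refine ⟨B.submatrix a.symm a.symm, fun x => ?_⟩
  obtain ⟨i, rfl⟩ := a.surjective x
  -- `s (a i)` with coefficient `1` and the `t (a j)` with coefficients `-B i j` form one family, so
  -- a single vanishing combination yields both the affine and the linear condition.
  have h0 : ∑ o : Option (Fin r), (o.elim (1 : ℝ) fun j => -B i j) •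
      prodCoord G H (o.elim (s (a i)) fun j => t (a j)) = 0 := by
    rw [Fintype.sum_option, ← key i]
    simp [Finset.sum_neg_distrib]
  obtain ⟨h1, h2⟩ := (sum_smul_prodCoord_eq_zero_iff hG hH
    (fun o : Option (Fin r) => o.elim (1 : ℝ) fun j => -B i j)
    (P := fun o : Option (Fin r) => o.elim (s (a i)) fun j => t (a j))
    (by rintro (_ | j) <;> simp [hs, ht])).1 h0
  rw [Fintype.sum_option] at h1 h2
  simp only [Option.elim, one_smul, Finset.sum_neg_distrib, neg_smul] at h1 h2
  rw [← Equiv.sum_comp a, ← Equiv.sum_comp a]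
  simp only [Matrix.submatrix_apply, Equiv.symm_apply_apply]
  exact ⟨by linarith, add_neg_eq_zero.1 h2⟩

lemma injective_of_coordDet_ne_zero {α l : Type*} {col : Fin r → l} {y : Fin r → α}
    {z : α → l → ℝ} (h : coordDet col (fun i => z (y i)) ≠ 0) : Function.Injective y := by
  intro i j hij
  by_contra hne
  exact h (coordDet_eq_zero_of_eq col hne (by rw [hij]))

end Count

/-! ### Valuation of the simplices by orientation -/

section Main

variable {E F C : Type*} [AddCommGroup E] [Module ℝ E] [AddCommGroup F] [Module ℝ F] {n m : ℕ}
  {p : Fin (n + 1) → E} {q : Fin (m + 1) → F} {G : E × ℝ →ₗ[ℝ] (Fin (n + 1) → ℝ)}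
  {H : F × ℝ →ₗ[ℝ] (Fin (m + 1) → ℝ)} {k : Fin (m + 1) → ℕ}
  {col : Fin (n + m + 1) → Fin (n + 1) ⊕ Fin (m + 1)} {i₀ : Fin (n + 1)}
  {T : Geometry.SimplicialComplex ℝ (E × F)} {f : E × F → C}
  {g : T.vertices → Fin (n + 1) × Fin (m + 1)}

/-- A simplex that is labelled as a simplex of type `k` has nonzero determinants, and the
determinant of the label simplex is a unit. -/
lemma LabelledAs.exists_enumeration (hT : IsTriangulation T (productPolytope p q))
    (hG : IsBarycentricMap p G) (hH : IsBarycentricMap q H) (hcol : IsChart Finset.univ i₀ col)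
    (hinj : Set.InjOn f (productVertices p q))
    (hgf : ∀ x : T.vertices, f x = f (vertexPoint p q (g x)))
    {σ τ : Finset (E × F)} (hσ : σ ∈ T.faces) (hτ : IsTypeSimplex p q k τ) {e : σ ≃ τ}
    (he : PreservesLabels f e) :
    ∃ v : Fin (n + m + 1) → T.vertices, Function.Injective v ∧
      (∀ x, x ∈ σ ↔ ∃ i, (v i : E × F) = x) ∧
      coordDet col (fun i => prodCoord G H (v i : E × F)) ≠ 0 ∧
      typeDet k col (fun i => g (v i)) ≠ 0 ∧
      ∀ [DecidableEq σ] (A : Matrix σ σ ℝ),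
        IsBarycentricMatrix (fun v : σ => (v : E × F)) (fun v : σ => (e v : E × F)) A →
        coordDet col (fun i => prodCoord G H (v i : E × F)) =
          A.det * typeDet k col (fun i => g (v i)) := by
  classical
  have hcard : σ.card = n + m + 1 := by
    rw [← hτ.card_eq]
    simpa using Fintype.card_congr e
  set a : Fin (n + m + 1) ≃ σ := (σ.equivFinOfCardEq hcard).symm with ha
  set v : Fin (n + m + 1) → T.vertices := fun i => ⟨a i, T.down_closed hσ
    (Finset.singleton_subset_iff.2 (a i).2) (Finset.singleton_nonempty _)⟩ with hv
  -- Extreme points have different colours, so a colour-preserving bijection has to agree with the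
  -- labelling `g`.
  have hpt : ∀ i, (e (a i) : E × F) = vertexPoint p q (g (v i)) := by
    intro i
    refine hinj (hτ.subset (e (a i)).2) ⟨⟨_, rfl⟩, ⟨_, rfl⟩⟩ ?_
    rw [he (a i), ← hgf (v i)]
  have hdet : coordDet col (fun i => prodCoord G H (v i : E × F)) ≠ 0 :=
    (affineIndependent_iff_coordDet_ne_zero hG hH hcol fun i => hT.vertex_mem (v i)).1
      ((affineIndependent_equiv a).2 (T.indep hσ))
  have hind : AffineIndependent ℝ fun i => vertexPoint p q (g (v i)) := by
    have := (affineIndependent_equiv (a.trans e)).2 hτ.indep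
    convert this using 1
    funext i
    exact (hpt i).symm
  have hdet' := (affineIndependent_iff_coordDet_ne_zero hG hH hcol
    fun i => vertexPoint_mem (g (v i))).1 hind
  simp only [prodCoord_vertexPoint hG hH] at hdet'
  have htype : ∀ j, typeCount (fun i => g (v i)) j = k j := by
    intro j
    rw [← hτ.type_eq j, ← ncard_eq_typeCount hH.injective hind.injective (τ := τ) fun w => ?_]
    constructor
    · intro hw
      refine ⟨a.symm (e.symm ⟨w, hw⟩), ?_⟩
      rw [← hpt]; simp
    · rintro ⟨i, rfl⟩
      rw [← hpt]; exact (e (a i)).2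
  have htd : typeDet k col (fun i => g (v i)) =
      coordDet col fun i => vertexVector (g (v i)) := if_pos htype
  refine ⟨v, fun i j (h : v i = v j) => a.injective
    (Subtype.ext (show ((v i : T.vertices) : E × F) = v j by rw [h])), fun x => ?_, hdet,
    by rwa [htd], fun A hA => ?_⟩
  · constructor
    · intro hx
      exact ⟨a.symm ⟨x, hx⟩, by simp [hv]⟩
    · rintro ⟨i, rfl⟩; exact (a i).2
  · have := hA.coordDet_eq (G := G) (H := H) (col := col) a
    simp only [hpt, prodCoord_vertexPoint hG hH] at this
    rw [htd, ← this]

/-- An enumeration with nonvanishing determinants is labelled as a simplex of type `k`. -/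
lemma exists_labelledAs (hT : IsTriangulation T (productPolytope p q))
    (hG : IsBarycentricMap p G) (hH : IsBarycentricMap q H) (hcol : IsChart Finset.univ i₀ col)
    (hgf : ∀ x : T.vertices, f x = f (vertexPoint p q (g x)))
    {v : Fin (n + m + 1) → T.vertices} {σ : Finset (E × F)}
    (hσ : ∀ x, x ∈ σ ↔ ∃ i, (v i : E × F) = x) (hv : Function.Injective v)
    (hg : typeDet k col (fun i => g (v i)) ≠ 0) :
    ∃ τ, IsTypeSimplex p q k τ ∧ ∃ e : σ ≃ τ, PreservesLabels f e ∧ ∃ A : Matrix σ σ ℝ,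
      IsBarycentricMatrix (fun v : σ => (v : E × F)) (fun v : σ => (e v : E × F)) A ∧
      ∀ [DecidableEq σ], coordDet col (fun i => prodCoord G H (v i : E × F)) =
        A.det * typeDet k col (fun i => g (v i)) := by
  classical
  have htype : ∀ j, typeCount (fun i => g (v i)) j = k j := by
    by_contra h
    exact hg (if_neg h)
  have htd : typeDet k col (fun i => g (v i)) =
      coordDet col fun i => vertexVector (g (v i)) := if_pos htype
  rw [htd] at hg ⊢
  have hdet : coordDet col (fun i => prodCoord G H (vertexPoint p q (g (v i)))) ≠ 0 := by
    simpa only [prodCoord_vertexPoint hG hH] using hg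
  have hind := (affineIndependent_iff_coordDet_ne_zero hG hH hcol
    fun i => vertexPoint_mem (g (v i))).2 hdet
  set τ : Finset (E × F) := Finset.univ.image fun i => vertexPoint p q (g (v i)) with hτ
  have hmem : ∀ w, w ∈ τ ↔ ∃ i, vertexPoint p q (g (v i)) = w := fun w => by simp [hτ]
  set a : Fin (n + m + 1) ≃ σ := Equiv.ofBijective (fun i => ⟨v i, (hσ _).2 ⟨i, rfl⟩⟩)
    ⟨fun i j h => hv (Subtype.ext (by simpa using h)), fun x => by
      obtain ⟨i, hi⟩ := (hσ x).1 x.2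
      exact ⟨i, Subtype.ext hi⟩⟩ with ha
  set b : Fin (n + m + 1) ≃ τ := Equiv.ofBijective
    (fun i => ⟨vertexPoint p q (g (v i)), (hmem _).2 ⟨i, rfl⟩⟩)
    ⟨fun i j h => hind.injective (congrArg Subtype.val h), fun x => by
      obtain ⟨i, hi⟩ := (hmem x).1 x.2
      exact ⟨i, Subtype.ext hi⟩⟩ with hb
  have hbi : ∀ i, (((a.symm.trans b) (a i) : τ) : E × F) = vertexPoint p q (g (v i)) := by
    intro i
    rw [Equiv.trans_apply, Equiv.symm_apply_apply]; rfl
  obtain ⟨A, hA⟩ := exists_isBarycentricMatrix hG hH hcol (s := fun x : σ => (x : E × F))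
    (t := fun x : σ => ((a.symm.trans b) x : E × F)) a
    (fun x => by
      obtain ⟨i, rfl⟩ := a.surjective x
      exact hT.vertex_mem (v i))
    (fun x => by
      obtain ⟨i, rfl⟩ := a.surjective x
      simp only [hbi]
      exact vertexPoint_mem _)
    (by simpa only [hbi] using hdet)
  refine ⟨τ, ⟨?_, ?_, ?_, ?_⟩, a.symm.trans b, ?_, A, hA, ?_⟩
  · intro w hw
    obtain ⟨i, rfl⟩ := (hmem w).1 hw
    exact ⟨⟨_, rfl⟩, ⟨_, rfl⟩⟩
  · rw [hτ, Finset.card_image_of_injective _ hind.injective, Finset.card_univ, Fintype.card_fin]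
  · exact (affineIndependent_equiv b).1 hind
  · intro j
    rw [ncard_eq_typeCount hH.injective hind.injective hmem, htype]
  · intro x
    obtain ⟨i, rfl⟩ := a.surjective x
    rw [hbi, ← hgf (v i)]; rfl
  · intro _
    have := hA.coordDet_eq (G := G) (H := H) (col := col) a
    simp only [hbi, prodCoord_vertexPoint hG hH] at this
    rw [← this]; rfl

lemma orient_eq_or {l : Type*} {r : ℕ} (col : Fin r → l) (z : Fin r → l → ℝ) :
    orient col z = 0 ∨ orient col z = 1 ∨ orient col z = -1 := by
  rcases lt_trichotomy (coordDet col z) 0 with h | h | h <;> simp [orient, h]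

lemma typeDet_eq_or {ι κ : Type*} [Fintype ι] [Fintype κ] [DecidableEq ι] [DecidableEq κ] {r : ℕ}
    (k : κ → ℕ) {col : Fin r → ι ⊕ κ} (hcol : Function.Injective col) (y : Fin r → ι × κ) :
    typeDet k col y = 0 ∨ typeDet k col y = 1 ∨ typeDet k col y = -1 := by
  rw [typeDet]
  split_ifs
  · exact coordDet_vertexVector r col hcol y
  · exact .inl rfl

/-- There is a valuation of the simplices, with values `1` and `-1` on those labelled as simplices
of type `k` with the same and the opposite orientation, and `0` on the other ones, whose sum
is `1`. -/
theorem exists_valuation (hT : IsTriangulation T (productPolytope p q))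
    (hp : AffineIndependent ℝ p) (hq : AffineIndependent ℝ q)
    (hf : IsGeneralizedSperner (productCells p q) (productVertices p q) T f)
    (hinj : Set.InjOn f (productVertices p q)) (hk_pos : ∀ j, 1 ≤ k j)
    (hk : ∑ j, k j = n + m + 1) [Fintype T.vertices] :
    ∃ val : Finset T.vertices → ℝ, (∀ s, val s = 0 ∨ val s = 1 ∨ val s = -1) ∧ ∑ s, val s = 1 ∧
      (∀ s, val s ≠ 0 → s.map (Function.Embedding.subtype _) ∈ T.faces) ∧
      (∀ s, s.map (Function.Embedding.subtype _) ∈ T.faces →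
        ((∃ τ, IsTypeSimplex p q k τ ∧
          LabelledAs f (s.map (Function.Embedding.subtype _)) τ) ↔ val s ≠ 0) ∧
        ((∃ τ, IsTypeSimplex p q k τ ∧
          LabelledAsSame f (s.map (Function.Embedding.subtype _)) τ) ↔ val s = 1) ∧
        ((∃ τ, IsTypeSimplex p q k τ ∧
          LabelledAsOpposite f (s.map (Function.Embedding.subtype _)) τ) ↔ val s = -1)) := by
  classical
  obtain ⟨G, hG⟩ := exists_isBarycentricMap hp
  obtain ⟨H, hH⟩ := exists_isBarycentricMap hq
  obtain ⟨g, hg, hgf⟩ := hf.exists_labelling hT hG hH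
  obtain ⟨col, hcol⟩ := exists_isChart n m
  have hF := hT.isFan hG hH
  have htotal := total_eq_factorial hF hg _ _ k col hcol (fun j => by simp [hk_pos j]) hk
  set Φ : T.vertices → Fin (n + 1) ⊕ Fin (m + 1) → ℝ := fun x => prodCoord G H (x : E × F) with hΦ
  set φ : (Fin (n + m + 1) → T.vertices) → ℝ := fun v =>
    if Admissible (vertexFan T) Φ Finset.univ v then
      orient col (fun i => Φ (v i)) * typeDet k col (fun i => g (v i)) else 0 with hφ
  have hperm : ∀ v (π : Equiv.Perm (Fin (n + m + 1))), φ (v ∘ π) = φ v := by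
    intro v π
    simp only [hφ, Admissible.comp_perm]
    have e1 : (fun a => Φ ((v ∘ π) a)) = (fun a => Φ (v a)) ∘ π := rfl
    have e2 : (fun a => g ((v ∘ π) a)) = (fun a => g (v a)) ∘ π := rfl
    rw [e1, e2, orient_comp_perm, typeDet_comp_perm, mul_mul_mul_comm]
    rcases Int.units_eq_one_or (Equiv.Perm.sign π) with h | h <;> simp [h]
  have hni : ∀ v, ¬ Function.Injective v → φ v = 0 := by
    intro v hv
    simp only [hφ]
    rw [orient_eq_zero (not_not.1 fun h => hv (injective_of_coordDet_ne_zero h)), zero_mul,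
      ite_self]
  obtain ⟨val, hval, hsupp, hsum⟩ := exists_sum_tuples_eq φ hperm hni
  have hφ3 : ∀ v, φ v = 0 ∨ φ v = 1 ∨ φ v = -1 := by
    intro v
    simp only [hφ]
    split_ifs
    · rcases orient_eq_or col (fun i => Φ (v i)) with h1 | h1 | h1 <;>
      rcases typeDet_eq_or k hcol.inj (fun i => g (v i)) with h2 | h2 | h2 <;> simp [h1, h2]
    · simp
  have hmemσ : ∀ (v : Fin (n + m + 1) → T.vertices) (x : E × F),
      x ∈ (Finset.univ.image v).map (Function.Embedding.subtype (· ∈ T.vertices)) ↔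
        ∃ i, (v i : E × F) = x := by
    intro v x
    simp only [Finset.mem_map, Finset.mem_image, Finset.mem_univ, true_and]
    constructor
    · rintro ⟨_, ⟨i, rfl⟩, rfl⟩; exact ⟨i, rfl⟩
    · rintro ⟨i, rfl⟩; exact ⟨_, ⟨i, rfl⟩, rfl⟩
  have hadm : ∀ v : Fin (n + m + 1) → T.vertices,
      (Finset.univ.image v).map (Function.Embedding.subtype _) ∈ T.faces →
      Admissible (vertexFan T) Φ Finset.univ v := fun v h =>
    ⟨.inr h, fun i l hl => absurd (Finset.mem_univ l) hl⟩
  have hfwd : ∀ s : Finset T.vertices, s.map (Function.Embedding.subtype _) ∈ T.faces →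
      ∀ τ, IsTypeSimplex p q k τ → ∀ e : (s.map (Function.Embedding.subtype _) : Finset (E × F)) ≃ τ,
      PreservesLabels f e → val s ≠ 0 ∧ ∀ A, IsBarycentricMatrix
        (fun v : (s.map (Function.Embedding.subtype _) : Finset (E × F)) => (v : E × F))
        (fun v => (e v : E × F)) A → (0 < A.det → val s = 1) ∧ (A.det < 0 → val s = -1) := by
    intro s hs τ hτ e he
    obtain ⟨v, hvi, hvσ, hd, ht, hA⟩ :=
      LabelledAs.exists_enumeration hT hG hH hcol hinj hgf hs hτ he
    have hsv : s = Finset.univ.image v := by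
      refine Finset.map_injective (Function.Embedding.subtype _) ?_
      ext x
      rw [hvσ, hmemσ]
    have hv : val s = orient col (fun i => Φ (v i)) * typeDet k col (fun i => g (v i)) := by
      rw [hsv, hval v hvi]
      exact if_pos (hadm v (hsv ▸ hs))
    rw [hv]
    constructor
    · refine mul_ne_zero ?_ ht
      rcases lt_or_gt_of_ne hd with h | h <;> simp [orient, hΦ, h]
    · intro A hAb
      have hA' := hA A hAb
      -- The determinant of the simplex is `A.det * typeDet`, and `typeDet` is `1` or `-1`.
      -- Multiplying its sign by `typeDet` once more leaves the sign of `A.det`.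
      constructor <;> intro hdet <;>
        rcases typeDet_eq_or k hcol.inj (fun i => g (v i)) with h2 | h2 | h2
      · exact absurd h2 ht
      · rw [h2, mul_one] at hA'; rw [orient, hA', h2]; simp [hdet]
      · rw [h2, mul_neg_one] at hA'; rw [orient, hA', h2]; simp [hdet]
      · exact absurd h2 ht
      · rw [h2, mul_one] at hA'; rw [orient, hA', h2]; simp [hdet]
      · rw [h2, mul_neg_one] at hA'; rw [orient, hA', h2]; simp [hdet]
  have hfaces : ∀ s, val s ≠ 0 → s.map (Function.Embedding.subtype _) ∈ T.faces := by
    intro s hs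
    obtain ⟨v, hvi, rfl⟩ := hsupp s hs
    rw [hval v hvi] at hs
    have hv : Admissible (vertexFan T) Φ Finset.univ v := by
      by_contra h
      exact hs (if_neg h)
    -- A tuple of length `n + m + 1` is never empty, so the added empty simplex plays no role here.
    exact hv.1.resolve_left (Finset.image_nonempty.2 Finset.univ_nonempty).ne_empty
  have hbwd : ∀ s, val s ≠ 0 → ∃ τ, IsTypeSimplex p q k τ ∧
      ∃ e : (s.map (Function.Embedding.subtype _) : Finset (E × F)) ≃ τ,
      PreservesLabels f e ∧ ∃ A, IsBarycentricMatrix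
        (fun v : (s.map (Function.Embedding.subtype _) : Finset (E × F)) => (v : E × F))
        (fun v => (e v : E × F)) A ∧ (val s = 1 → 0 < A.det) ∧ (val s = -1 → A.det < 0) := by
    intro s hs
    have hsf := hfaces s hs
    obtain ⟨v, hvi, rfl⟩ := hsupp s hs
    have hv : val (Finset.univ.image v) =
        orient col (fun i => Φ (v i)) * typeDet k col (fun i => g (v i)) := by
      rw [hval v hvi]
      exact if_pos (hadm v hsf)
    have ht : typeDet k col (fun i => g (v i)) ≠ 0 := fun h => hs (by rw [hv, h, mul_zero])
    obtain ⟨τ, hτ, e, he, A, hA, hdet⟩ :=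
      exists_labelledAs hT hG hH hcol hgf (hmemσ v) hvi ht
    refine ⟨τ, hτ, e, he, A, hA, ?_⟩
    have hdet := hdet
    rw [hv, orient, hΦ, hdet]
    have h3 : ∀ x : ℝ, (SignType.sign x : ℝ) = 1 → 0 < x := by
      intro x hx
      rcases lt_trichotomy x 0 with h | h | h
      · rw [sign_neg h] at hx; norm_num at hx
      · rw [h, sign_zero] at hx; norm_num at hx
      · exact h
    have h4 : ∀ x : ℝ, (SignType.sign x : ℝ) = -1 → x < 0 := by
      intro x hx
      rcases lt_trichotomy x 0 with h | h | h
      · exact h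
      · rw [h, sign_zero] at hx; norm_num at hx
      · rw [sign_pos h] at hx; norm_num at hx
    rcases typeDet_eq_or k hcol.inj (fun i => g (v i)) with h2 | h2 | h2
    · exact absurd h2 ht
    · simp only [h2, mul_one]
      exact ⟨h3 _, h4 _⟩
    · simp only [h2, mul_neg, mul_one, Left.sign_neg, SignType.coe_neg, neg_neg]
      exact ⟨h3 _, h4 _⟩
  refine ⟨val, fun s => ?_, ?_, hfaces, fun s hs => ⟨⟨?_, fun h => ?_⟩, ⟨?_, fun h => ?_⟩,
    ⟨?_, fun h => ?_⟩⟩⟩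
  · by_cases h : val s = 0
    · exact .inl h
    · obtain ⟨v, hvi, rfl⟩ := hsupp s h
      rw [hval v hvi]; exact hφ3 v
  · have hne : ((n + m + 1).factorial : ℝ) ≠ 0 := by exact_mod_cast Nat.factorial_ne_zero _
    refine mul_left_cancel₀ hne ?_
    rw [← hsum, mul_one, ← htotal]
    rfl
  · rintro ⟨τ, hτ, e, he⟩
    exact (hfwd s hs τ hτ e he).1
  · obtain ⟨τ, hτ, e, he, -⟩ := hbwd s h
    exact ⟨τ, hτ, e, he⟩
  · rintro ⟨τ, hτ, e, he, A, hA, hdet⟩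
    refine ((hfwd s hs τ hτ e he).2 A hA).1 ?_
    convert hdet
  · obtain ⟨τ, hτ, e, he, A, hA, h1, -⟩ := hbwd s (by rw [h]; norm_num)
    refine ⟨τ, hτ, e, he, A, hA, ?_⟩
    convert h1 h
  · rintro ⟨τ, hτ, e, he, A, hA, hdet⟩
    refine ((hfwd s hs τ hτ e he).2 A hA).2 ?_
    convert hdet
  · obtain ⟨τ, hτ, e, he, A, hA, -, h1⟩ := hbwd s (by rw [h]; norm_num)
    refine ⟨τ, hτ, e, he, A, hA, ?_⟩
    convert h1 h

end Main

end SimplexProduct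

theorem mainTheorem2 {E F : Type*} [AddCommGroup E] [Module ℝ E] [AddCommGroup F] [Module ℝ F]
    (n m : ℕ) (p : Fin (n + 1) → E) (q : Fin (m + 1) → F)
    (hp : AffineIndependent ℝ p) (hq : AffineIndependent ℝ q)
    (T : Geometry.SimplicialComplex ℝ (E × F))
    (hT : SimplexProduct.IsTriangulation T (SimplexProduct.productPolytope p q))
    (f : E × F → Fin ((n + 1) * (m + 1)))
    (hf : SimplexProduct.IsGeneralizedSperner (SimplexProduct.productCells p q)
      (SimplexProduct.productVertices p q) T f)
    (hinj : Set.InjOn f (SimplexProduct.productVertices p q))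
    (k : Fin (m + 1) → ℕ) (hk_pos : ∀ j, 1 ≤ k j) (hk : ∑ j, k j = n + m + 1) :
    Odd {σ ∈ T.faces | ∃ τ, SimplexProduct.IsTypeSimplex p q k τ ∧
      SimplexProduct.LabelledAs f σ τ}.ncard ∧
    {σ ∈ T.faces | ∃ τ, SimplexProduct.IsTypeSimplex p q k τ ∧
      SimplexProduct.LabelledAsSame f σ τ}.ncard =
    {σ ∈ T.faces | ∃ τ, SimplexProduct.IsTypeSimplex p q k τ ∧
      SimplexProduct.LabelledAsOpposite f σ τ}.ncard + 1 := by
  classical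
  have : Fintype T.vertices := (SimplexProduct.finite_vertices hT.finite).fintype
  obtain ⟨val, h3, hsum, hfaces, hchar⟩ :=
    SimplexProduct.exists_valuation hT hp hq hf hinj hk_pos hk
  have hcount : ∀ (P : Finset (E × F) → Prop) (Q : Finset T.vertices → Prop)
      [DecidablePred Q], (∀ s, Q s → s.map (Function.Embedding.subtype _) ∈ T.faces) →
      (∀ s, s.map (Function.Embedding.subtype _) ∈ T.faces →
        (P (s.map (Function.Embedding.subtype _)) ↔ Q s)) →
      {σ ∈ T.faces | P σ}.ncard = (Finset.univ.filter Q).card := by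
    intro P Q _ hQ hPQ
    have : {σ ∈ T.faces | P σ} =
        (fun s : Finset T.vertices => s.map (Function.Embedding.subtype _)) ''
          (Finset.univ.filter Q : Finset (Finset T.vertices)) := by
      ext σ
      simp only [Set.mem_ofPred_eq, Set.mem_image, Finset.coe_filter, Finset.mem_univ, true_and]
      constructor
      · rintro ⟨hσ, hP⟩
        obtain ⟨s, rfl⟩ := SimplexProduct.exists_map_subtype_eq hσ
        exact ⟨s, (hPQ s hσ).1 hP, rfl⟩
      · rintro ⟨s, hs, rfl⟩
        exact ⟨hQ s hs, (hPQ s (hQ s hs)).2 hs⟩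
    rw [this, Set.ncard_image_of_injective _ (Finset.map_injective _), Set.ncard_coe_finset]
  rw [hcount _ (fun s => val s ≠ 0) hfaces fun s hs => (hchar s hs).1,
    hcount _ (fun s => val s = 1) (fun s hs => hfaces s (by rw [hs]; norm_num))
      fun s hs => (hchar s hs).2.1,
    hcount _ (fun s => val s = -1) (fun s hs => hfaces s (by rw [hs]; norm_num))
      fun s hs => (hchar s hs).2.2]
  -- With values in `{0, 1, -1}`, the sum of `val` is the difference of the two counts.
  have hdiff : ((Finset.univ.filter fun s => val s = 1).card : ℝ) =
      (Finset.univ.filter fun s => val s = -1).card + 1 := by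
    refine Eq.trans ?_ (congrArg (_ + ·) hsum)
    rw [Finset.card_filter, Finset.card_filter]
    push_cast
    rw [← Finset.sum_add_distrib]
    refine Finset.sum_congr rfl fun s _ => ?_
    rcases h3 s with h | h | h <;> norm_num [h]
  have hdiff' : (Finset.univ.filter fun s => val s = 1).card =
      (Finset.univ.filter fun s => val s = -1).card + 1 := by exact_mod_cast hdiff
  have hunion : (Finset.univ.filter fun s => val s ≠ 0).card =
      (Finset.univ.filter fun s => val s = 1).card +
        (Finset.univ.filter fun s => val s = -1).card := by
    rw [Finset.card_filter, Finset.card_filter, Finset.card_filter, ← Finset.sum_add_distrib]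
    refine Finset.sum_congr rfl fun s _ => ?_
    rcases h3 s with h | h | h <;> norm_num [h]
  refine ⟨⟨(Finset.univ.filter fun s => val s = -1).card, ?_⟩, hdiff'⟩
  rw [hunion, hdiff']
  ring
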